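/- **Setting.** Fix a countably infinite set $\mathsf V$ of variables and, for every $n\in\mathbb N$, countably infinitely many $n$-ary predicate symbols (effectively enumerated). Formulas of LPFD are given by $$\varphi ::= P\vec x \mid D_X y \mid \neg\varphi \mid \varphi\wedge\varphi \mid [\![X,Y,Z]\!]\varphi ,$$ where $X,Y,Z\subseteq\mathsf V$ are finite and $y\in\mathsf V$; put $\langle X,Y,Z\rangle\varphi := \neg[\![X,Y,Z]\!]\neg\varphi$, $\mathbb D_X\varphi:=[\![X,\varnothing,\varnothing]\!]\varphi$, $D_XY:=\bigwedge_{y\in Y}D_Xy$. A PD-model consists of a non-empty set $O$, relations $I(P)\subseteq O^{n}$ for $n$-ary $P$, a set $A\subseteq O^{\mathsf V}$, and a pre-order $\preceq_x$ on $A$ for each $x\in\mathsf V$, with strict part $\prec_x$. Truth at $a\in A$: $P\vec x$ holds iff $a(\vec x)\in I(P)$; $D_Xy$ holds iff every $a'\in A$ that agrees with $a$ on $X$ has $a'(y)=a(y)$; Boolean connectives as usual; $[\![X,Y,Z]\!]\varphi$ holds iff $\varphi$ holds at every $a'\in A$ that agrees with $a$ on $X$ and satisfies $a\preceq_y a'$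 for all $y\in Y$ and $a\prec_z a'$ for all $z\in Z$. A formula is satisfiable if it is true at some $a\in A$ of some PD-model; two formulas are (modally) equivalent if they are true at the same points of all PD-models. Let $\vdash$ be derivability in the Hilbert calculus with all propositional tautologies, modus ponens, the rule from $\varphi$ infer $[\![X,Y,Z]\!]\varphi$, the axiom K for each $[\![X,Y,Z]\!]$, and the axioms * $[\![X,Y,\varnothing]\!]\varphi\to\varphi$; * $\langle X,Y,Z\rangle\langle X',Y',Z'\rangle\varphi\to\langle X\cap X',Y\cap Y',(Z\cap Y')\cup(Z\cap Z')\cup(Y\cap Z')\rangle\varphi$; * $[\![X,Y,Z]\!]\varphi\to[\![X',Y',Z']\!]\varphi$ if $X\subseteq X'$, $Y\subseteq Y'$, $Z\subseteq Z'$; * $\langle X,Y,Z\rangle\varphi\to\langle X,Y\cup Z,Z\rangle\varphi$; * $(\varphi\wedge\langle X,Y,Z\rangle\psi)\to\langle X,Y,Z\rangle(\psi\wedge\langle X,Y,\varnothing\rangle\varphi)\vee\bigvee_{y\in Y}\langle X,Y,Z\cup\{y\}\rangle\psi$; * $D_XX$; $\ D_XS\wedge D_ST\to D_XT$; $\ D_XS\wedge[\![S,Y,Z]\!]\varphi\to[\![X,Y,Z]\!]\varphi$;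 * $\varphi\to\mathbb D_X\varphi$ if $\varphi$ is $P\vec x$ with all $x_i\in X$, or $D_Yz$ with $Y\subseteq X$. $\Gamma\vdash\varphi$ means that $\vdash\bigwedge\Gamma_0\to\varphi$ for some finite $\Gamma_0\subseteq\Gamma$. For a formula $\alpha$, let $\mathsf V_\alpha$ be the set of variables occurring in $\alpha$, and let $\mathcal L_\alpha$ be the set of formulas whose variables and predicate symbols all occur in $\alpha$ and whose modal degree is at most that of $\alpha$. An $\mathcal L_\alpha$-maximal consistent set (MCS) is a set $\Gamma\subseteq\mathcal L_\alpha$ with $\Gamma\not\vdash\bot$ such that $\Gamma'\vdash\bot$ whenever $\Gamma\subsetneq\Gamma'\subseteq\mathcal L_\alpha$. For such sets $\Delta,\Sigma$ write $\Delta\,R^p_\alpha(X,Y,Z)\,\Sigma$ if, whenever $\langle X',Y',Z'\rangle\varphi\in\Sigma$ and $\chi:=\langle X\cap X',Y\cap Y',(Z\cap Y')\cup(Z'\cap Y)\cup(Z\cap Z')\rangle\varphi\in\mathcal L_\alpha$, then $\chi\in\Delta$. A formula $\langle X,Y,Z\rangle\varphi\in\Delta$ is saturated in $\Delta$ if $Y\cap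 Z=\varnothing$ and $\langle X,Y,Z\cup\{y\}\rangle\varphi\notin\Delta$ for all $y\in Y$. An $\mathcal L_\alpha$-pre-model is a set $F$ of $\mathcal L_\alpha$-MCSs such that for all $X,Y,Z\subseteq\mathsf V_\alpha$ and all $\Delta\in F$, if $\langle X,Y,Z\rangle\varphi$ is saturated in $\Delta$, then there is $\Sigma\in F$ with $\Delta\,R^p_\alpha(X,Y,Z)\,\Sigma$, $\varphi\in\Sigma$ and $\Sigma\,R^p_\alpha(X,Y,\varnothing)\,\Delta$. A formula is satisfied in $F$ if it belongs to some $\Delta\in F$. **Theorem.** The satisfiability problem of LPFD is decidable: the set of Gödel numbers of satisfiable LPFD formulas is computable. Moreover, for every formula $\alpha$: 1. $\alpha$ is satisfiable if and only if $\alpha$ is satisfied in some $\mathcal L_\alpha$-pre-model; 2. up to equivalence, $\mathcal L_\alpha$ contains only finitely many formulas, and there are only finitely many $\mathcal L_\alpha$-maximal consistent sets (so there are only finitely many $\mathcal L_\alpha$-pre-models). -/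

import Mathlib

universe u

namespace LPFD

/-- Variables (players): a countably infinite set. -/
abbrev Var : Type := ℕ

/-- Predicate symbols: the pair `(n, k)` is the `k`-th symbol of arity `n`, so that there are
countably infinitely many symbols of every arity. -/
abbrev Pred : Type := ℕ × ℕ

/-- The arity of a predicate symbol. -/
abbrev ar (P : Pred) : ℕ := P.1

/-- Formulas of LPFD: `P x⃗`, `D_X y`, `¬ φ`, `φ ∧ ψ` and `⟦X, Y, Z⟧ φ`. -/
inductive Formula : Type
  | atom (P : Pred) (x : Fin (ar P) → Var) : Formula
  | dep (X : Finset Var) (y : Var) : Formula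
  | neg (φ : Formula) : Formula
  | and (φ ψ : Formula) : Formula
  | box (X Y Z : Finset Var) (φ : Formula) : Formula

namespace Formula

/-- The abbreviation `φ → ψ`. -/
def imp (φ ψ : Formula) : Formula := neg (and φ (neg ψ))

/-- The abbreviation `φ ∨ ψ`. -/
def or (φ ψ : Formula) : Formula := neg (and (neg φ) (neg ψ))

/-- `⊥`, a fixed propositional contradiction. -/
def bot : Formula :=
  and (atom (0, 0) Fin.elim0) (neg (atom (0, 0) Fin.elim0))

/-- `⊤`. -/
def top : Formula := neg bot

/-- The dual modality `⟨X, Y, Z⟩ φ`. -/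
def dia (X Y Z : Finset Var) (φ : Formula) : Formula := neg (box X Y Z (neg φ))

/-- Conjunction of a finite list of formulas (`⊤` for the empty list). -/
def conj : List Formula → Formula
  | [] => top
  | φ :: l => and φ (conj l)

/-- Disjunction of a finite list of formulas (`⊥` for the empty list). -/
def disj : List Formula → Formula
  | [] => bot
  | φ :: l => or φ (disj l)

/-- The abbreviation `D_X Y`, the conjunction of all `D_X y` with `y ∈ Y`. -/
def depSet (X Y : Finset Var) : Formula :=
  conj ((Y.sort (· ≤ ·)).map fun y => dep X y)

/-- The variables occurring in a formula. -/
def vars : Formula → Finset Var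
  | atom _ x => Finset.univ.image x
  | dep X y => insert y X
  | neg φ => φ.vars
  | and φ ψ => φ.vars ∪ ψ.vars
  | box X Y Z φ => X ∪ Y ∪ Z ∪ φ.vars

/-- The predicate symbols occurring in a formula. -/
def preds : Formula → Finset Pred
  | atom P _ => {P}
  | dep _ _ => ∅
  | neg φ => φ.preds
  | and φ ψ => φ.preds ∪ ψ.preds
  | box _ _ _ φ => φ.preds

/-- The modal degree of a formula; `D_X y` counts as an atomic formula. -/
def degree : Formula → ℕ
  | atom _ _ => 0
  | dep _ _ => 0
  | neg φ => φ.degree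
  | and φ ψ => max φ.degree ψ.degree
  | box _ _ _ φ => φ.degree + 1

/-- The bit mask of a finite set of variables. -/
def codeSet (X : Finset Var) : ℕ := ∑ i ∈ X, 2 ^ i

/-- The Gödel number of a formula. -/
def code : Formula → ℕ
  | atom P x => Nat.pair 0 (Nat.pair (Nat.pair P.1 P.2) (Encodable.encode (List.ofFn x)))
  | dep X y => Nat.pair 1 (Nat.pair (codeSet X) y)
  | neg φ => Nat.pair 2 φ.code
  | and φ ψ => Nat.pair 3 (Nat.pair φ.code ψ.code)
  | box X Y Z φ =>
      Nat.pair 4 (Nat.pair (Nat.pair (codeSet X) (codeSet Y)) (Nat.pair (codeSet Z) φ.code))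

theorem codeSet_injective : Function.Injective codeSet :=
  Finset.geomSum_injective le_rfl

/-- Distinct formulas have distinct Gödel numbers. -/
theorem code_injective : Function.Injective code := by
  intro φ
  induction φ with
  | atom P x =>
    intro ψ h
    cases ψ <;> simp only [code, Nat.pair_eq_pair] at h <;> try omega
    rename_i Q y
    obtain ⟨-, ⟨h1, h2⟩, h3⟩ := h
    obtain ⟨n, k⟩ := P
    obtain ⟨m, l⟩ := Q
    obtain rfl : n = m := h1
    obtain rfl : k = l := h2
    rw [List.ofFn_injective (Encodable.encode_injective h3)]
  | dep X y =>
    intro ψ h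
    cases ψ <;> simp only [code, Nat.pair_eq_pair] at h <;> try omega
    rw [codeSet_injective h.2.1, h.2.2]
  | neg φ ih =>
    intro ψ h
    cases ψ <;> simp only [code, Nat.pair_eq_pair] at h <;> try omega
    rw [ih h.2]
  | and φ₁ φ₂ ih₁ ih₂ =>
    intro ψ h
    cases ψ <;> simp only [code, Nat.pair_eq_pair] at h <;> try omega
    rw [ih₁ h.2.1, ih₂ h.2.2]
  | box X Y Z φ ih =>
    intro ψ h
    cases ψ <;> simp only [code, Nat.pair_eq_pair] at h <;> try omega
    rw [codeSet_injective h.2.1.1, codeSet_injective h.2.1.2, codeSet_injective h.2.2.1,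
      ih h.2.2.2]

end Formula

/-- A preference dependence model: a non-empty set `O` of actions, an interpretation `I` of the
predicate symbols, a set `A` of admissible assignments (strategy profiles), and for every
variable `x` a pre-order `pref x` on `A`. -/
structure PDModel where
  O : Type u
  nonempty : Nonempty O
  I : (P : Pred) → Set (Fin (ar P) → O)
  A : Set (Var → O)
  pref : Var → A → A → Prop
  pref_refl : ∀ x a, pref x a a
  pref_trans : ∀ x a b c, pref x a b → pref x b c → pref x a c

namespace PDModel

/-- `a =_X b`: the assignments agree on `X`. -/
def agree (M : PDModel.{u}) (X : Finset Var) (a b : M.A) : Prop :=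
  ∀ x ∈ X, a.1 x = b.1 x

/-- The strict part of the pre-order of `x`. -/
def strict (M : PDModel.{u}) (x : Var) (a b : M.A) : Prop :=
  M.pref x a b ∧ ¬ M.pref x b a

/-- Truth of a formula at an admissible assignment. -/
def Sat (M : PDModel.{u}) : M.A → Formula → Prop
  | a, .atom P x => (fun i => a.1 (x i)) ∈ M.I P
  | a, .dep X y => ∀ b : M.A, M.agree X a b → a.1 y = b.1 y
  | a, .neg φ => ¬ M.Sat a φ
  | a, .and φ ψ => M.Sat a φ ∧ M.Sat a ψ
  | a, .box X Y Z φ => ∀ b : M.A,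
      M.agree X a b → (∀ y ∈ Y, M.pref y a b) → (∀ z ∈ Z, M.strict z a b) → M.Sat b φ

end PDModel

/-- A formula is satisfiable if it is true at some assignment of some PD-model. -/
def Satisfiable (φ : Formula) : Prop :=
  ∃ (M : PDModel.{u}) (a : M.A), M.Sat a φ

/-- Two formulas are modally equivalent if they are true at the same assignments of all
PD-models. -/
def Equivalent (φ ψ : Formula) : Prop :=
  ∀ (M : PDModel.{u}) (a : M.A), M.Sat a φ ↔ M.Sat a ψ

/-- Propositional tautologies: formulas true under every truth assignment to all formulas which
respects negation and conjunction. -/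
def Tautology (φ : Formula) : Prop :=
  ∀ v : Formula → Prop,
    (∀ ψ, v (.neg ψ) ↔ ¬ v ψ) → (∀ ψ χ, v (.and ψ χ) ↔ v ψ ∧ v χ) → v φ

/-- `Atom(X)`: the formulas `P x⃗` and `D_Y z` with `x⃗` in `X`, respectively with `Y ⊆ X`. -/
inductive AtomOver (X : Finset Var) : Formula → Prop
  | atom (P : Pred) (x : Fin (ar P) → Var) (h : ∀ i, x i ∈ X) : AtomOver X (.atom P x)
  | dep (Y : Finset Var) (z : Var) (h : Y ⊆ X) : AtomOver X (.dep Y z)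

open Formula in
/-- Theorems of the Hilbert-style calculus of LPFD. -/
inductive Theorem : Formula → Prop
  | taut {φ} (h : Tautology φ) : Theorem φ
  | mp {φ ψ} (h : Theorem (imp φ ψ)) (h' : Theorem φ) : Theorem ψ
  | nec (X Y Z) {φ} (h : Theorem φ) : Theorem (box X Y Z φ)
  | k (X Y Z φ ψ) :
      Theorem (imp (box X Y Z (imp φ ψ)) (imp (box X Y Z φ) (box X Y Z ψ)))
  | ordA (X Y φ) : Theorem (imp (box X Y ∅ φ) φ)
  | ordB (X Y Z X' Y' Z' φ) :
      Theorem (imp (dia X Y Z (dia X' Y' Z' φ))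
        (dia (X ∩ X') (Y ∩ Y') ((Z ∩ Y') ∪ (Z ∩ Z') ∪ (Y ∩ Z')) φ))
  | ordC {X Y Z X' Y' Z'} (φ) (hX : X ⊆ X') (hY : Y ⊆ Y') (hZ : Z ⊆ Z') :
      Theorem (imp (box X Y Z φ) (box X' Y' Z' φ))
  | ordD (X Y Z φ) : Theorem (imp (dia X Y Z φ) (dia X (Y ∪ Z) Z φ))
  | ordE (X Y Z φ ψ) :
      Theorem (imp (and φ (dia X Y Z ψ))
        (or (dia X Y Z (and ψ (dia X Y ∅ φ)))
          (disj ((Y.sort (· ≤ ·)).map fun y => dia X Y (Z ∪ {y}) ψ))))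
  | depA (X) : Theorem (depSet X X)
  | depB {X φ} (h : AtomOver X φ) : Theorem (imp φ (box X ∅ ∅ φ))
  | depC (X S T) : Theorem (imp (and (depSet X S) (depSet S T)) (depSet X T))
  | depD (X S Y Z φ) :
      Theorem (imp (and (depSet X S) (box S Y Z φ)) (box X Y Z φ))

/-- `Γ ⊢ φ`: some finite conjunction of members of `Γ` provably implies `φ`. -/
def Derives (Γ : Set Formula) (φ : Formula) : Prop :=
  ∃ l : List Formula, (∀ ψ ∈ l, ψ ∈ Γ) ∧ Theorem (.imp (.conj l) φ)

/-- The fragment `L_α`: formulas in the vocabulary of `α` of modal degree at most that of `α`. -/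
def Fragment (α : Formula) : Set Formula :=
  {φ | φ.vars ⊆ α.vars ∧ φ.preds ⊆ α.preds ∧ φ.degree ≤ α.degree}

/-- `Γ` is an `L_α`-maximal consistent set. -/
def IsMCS (α : Formula) (Γ : Set Formula) : Prop :=
  Γ ⊆ Fragment α ∧ ¬ Derives Γ .bot ∧
    ∀ Γ' : Set Formula, Γ ⊂ Γ' → Γ' ⊆ Fragment α → Derives Γ' .bot

/-- The relation `Δ R^p_α(X, Y, Z) Θ`. -/
def Rp (α : Formula) (X Y Z : Finset Var) (Δ Θ : Set Formula) : Prop :=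
  ∀ (X' Y' Z' : Finset Var) (φ : Formula), Formula.dia X' Y' Z' φ ∈ Θ →
    Formula.dia (X ∩ X') (Y ∩ Y') ((Z ∩ Y') ∪ (Z' ∩ Y) ∪ (Z ∩ Z')) φ ∈ Fragment α →
    Formula.dia (X ∩ X') (Y ∩ Y') ((Z ∩ Y') ∪ (Z' ∩ Y) ∪ (Z ∩ Z')) φ ∈ Δ

/-- `⟨X, Y, Z⟩ φ` is a saturated formula in `Δ`. That the disjunction of the formulas
`⟨X, Y, Z ∪ {y}⟩ φ`, for `y ∈ Y`, is not in the maximal consistent set `Δ` is expressed by saying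
that none of its disjuncts is. -/
def SaturatedIn (Δ : Set Formula) (X Y Z : Finset Var) (φ : Formula) : Prop :=
  Formula.dia X Y Z φ ∈ Δ ∧ (∀ y ∈ Y, Formula.dia X Y (Z ∪ {y}) φ ∉ Δ) ∧ Y ∩ Z = ∅

/-- `F` is an `L_α`-pre-model. -/
def IsPreModel (α : Formula) (F : Set (Set Formula)) : Prop :=
  (∀ Δ ∈ F, IsMCS α Δ) ∧
    ∀ X Y Z : Finset Var, X ⊆ α.vars → Y ⊆ α.vars → Z ⊆ α.vars →
      ∀ Δ ∈ F, ∀ φ : Formula, SaturatedIn Δ X Y Z φ →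
        ∃ Θ ∈ F, Rp α X Y Z Δ Θ ∧ φ ∈ Θ ∧ Rp α X Y ∅ Θ Δ

/-- `φ` is satisfied in `F`. -/
def SatisfiedIn (F : Set (Set Formula)) (φ : Formula) : Prop :=
  ∃ Δ ∈ F, φ ∈ Δ

end LPFD

/-!
Satisfiability in LPFD reduces to the existence of a *Hintikka system* (`Hintikka`): a family of
types, that is, sets of formulas, which obey some local conditions. Two types may be joined by
transitions, labelled with the variables that keep their value, those that are indifferent and
those that strictly improve, and every failing dependence atom and every failing box has a
witnessing transition.

*From Hintikka systems to models* (`Hintikka.satisfiable`). The points of the model are the finite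
histories of transitions. The value of `x` at a history is the initial segment up to the last
transition that does not keep `x` (`anchor`), and the preference order of `y` is inclusion of sets
of initial segments (`rises`), so that equality of values and the pre-order laws need no proof. The
histories form a tree, and if two of them agree on `X` and are ordered for all `y ∈ Y`, then so is
every transition on the path between them (`path_induction`). Hence boxes and dependence atoms can
be carried along this path (`box_transport`, `atom_iff_of_agree`), which is the truth lemma.

*Pre-models* (`satisfiable_iff_exists_preModel`). The types of the points of a model form a
pre-model by soundness; saturation of a diamond says that the step to its witness is indifferent
for the variables of `Y`. Conversely, a pre-model is a Hintikka system (`IsPreModel.hintikka`): a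
failing box is first closed under dependence and then saturated. The derivations in the calculus
that this needs are carried out in *worlds* (`World`), two-valued truth assignments under which all
theorems are true; by Lindenbaum's lemma (`exists_world`) every maximal consistent set of a
fragment is the trace of a world.

*Finiteness*. By induction on the modal degree, the formulas of a fragment are Boolean combinations
of finitely many formulas up to provable equivalence (`exists_finite_boxes`), and so a world is
determined on the fragment by finitely many truth values. Both finiteness claims follow.

*Decidability* (`computablePred_satisfiable`). Types can be coded as bit masks of sets of Gödel
numbers, and finite families of types as bit masks of sets of such masks. The conditions on a
Hintikka system then become an arithmetical formula with bounded quantifiers, and the code of the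
family is itself bounded by a primitive recursive function of the Gödel number, because the types
of any model, cut off at a suitable bound, provide a certificate (`Satisfiable.hasCertificate`).
Therefore `HasCertificate` is primitive recursive, and it is equivalent to satisfiability.
-/

namespace LPFD

/-! ### Hintikka systems and their unravelling -/

/-- The label of a transition between two types: `X` holds variables whose values are kept,
`Y` those for which the two ends are equally good, `Z` those for which the target is strictly
better. -/
structure Label where
  X : Finset Var
  Y : Finset Var
  Z : Finset Var

/-- A transition labelled `L` from a point with type `T` to a point with type `S` is possible, as
far as the formulas in `G` and the boxes can tell. A box that is passed forward may drop from its
strict part the variables that `L` improves. -/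
structure Compat (G T S : Set Formula) (L : Label) : Prop where
  atom : ∀ φ ∈ G, AtomOver L.X φ → (φ ∈ T ↔ φ ∈ S)
  closed : ∀ Y z, .dep Y z ∈ G → Y ⊆ L.X → .dep Y z ∈ T → z ∈ L.X
  forward : ∀ X Y Z Z' φ, .box X Y Z φ ∈ T → X ⊆ L.X → Y ⊆ L.Y ∪ L.Z → Z ⊆ Y → Z' ⊆ Z →
    Z ⊆ Z' ∪ L.Z → .box X Y Z' φ ∈ S
  backward : ∀ X Y Z φ, .box X Y Z φ ∈ S → X ⊆ L.X → Y ⊆ L.Y → Z ⊆ Y → .box X Y Z φ ∈ T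

/-- `G` is closed under immediate subformulas. -/
structure SubClosed (G : Set Formula) : Prop where
  neg : ∀ φ, .neg φ ∈ G → φ ∈ G
  and : ∀ φ ψ, .and φ ψ ∈ G → φ ∈ G ∧ ψ ∈ G
  box : ∀ X Y Z φ, .box X Y Z φ ∈ G → φ ∈ G

/-- A family of types which satisfies the local conditions that hold for the sets of formulas true
at the points of a model, and in which every failing dependence and every failing box of `G` has a
witnessing transition. -/
structure Hintikka (G : Set Formula) {W : Type} (T : W → Set Formula) : Prop where
  neg : ∀ w φ, .neg φ ∈ G → (.neg φ ∈ T w ↔ φ ∉ T w)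
  and : ∀ w φ ψ, .and φ ψ ∈ G → (.and φ ψ ∈ T w ↔ φ ∈ T w ∧ ψ ∈ T w)
  refl : ∀ w X Y φ, .box X Y ∅ φ ∈ T w → φ ∈ T w
  norm : ∀ w X Y Z φ, .box X Y Z φ ∈ G → .box X Y Z φ ∈ T w → .box X (Y ∪ Z) Z φ ∈ T w
  dep_witness : ∀ w Y z, .dep Y z ∈ G → .dep Y z ∉ T w →
    ∃ w' L, Compat G (T w) (T w') L ∧ Y ⊆ L.X ∧ z ∉ L.X
  box_witness : ∀ w X Y Z φ, .box X Y Z φ ∈ G → .box X Y Z φ ∉ T w →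
    ∃ w' L, Compat G (T w) (T w') L ∧ X ⊆ L.X ∧ Y ⊆ L.Y ∪ L.Z ∧ Z ⊆ L.Z ∧ φ ∉ T w'

/-- A finite sequence of transitions, the latest first. -/
abbrev History (W : Type) := List (W × Label)

namespace History

variable {W : Type}

/-- The point reached by a history which starts at `r`. -/
def tip (r : W) : History W → W
  | [] => r
  | e :: _ => e.1

/-- All transitions of the history are compatible with the types of their ends. -/
def Valid (G : Set Formula) (T : W → Set Formula) (r : W) : History W → Prop
  | [] => True
  | e :: l => Valid G T r l ∧ Compat G (T (tip r l)) (T e.1) e.2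

/-- The value of the variable `x` at a history: the earliest history from which on all transitions
keep `x`. -/
def anchor (x : Var) : History W → History W
  | [] => []
  | e :: l => if x ∈ e.2.X then anchor x l else e :: l

/-- The initial segments of a history at which the standing of `y` was raised, back to the last
transition which is not monotone in `y`. Inclusion of these sets is the preference order
of `y`, which makes it a pre-order for free. -/
def rises (y : Var) : History W → Set (History W)
  | [] => {[]}
  | e :: l => if y ∈ e.2.Z then insert (e :: l) (rises y l)
      else if y ∈ e.2.Y then rises y l else {e :: l}

theorem anchor_suffix (x : Var) : ∀ l : History W, anchor x l <:+ l
  | [] => List.suffix_rfl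
  | e :: l => by
    rw [anchor]
    split_ifs
    · exact (anchor_suffix x l).trans (List.suffix_cons e l)
    · exact List.suffix_rfl

theorem suffix_of_mem_rises (y : Var) : ∀ l m : History W, m ∈ rises y l → m <:+ l
  | [], m, h => by
    rw [rises, Set.mem_singleton_iff] at h
    exact h ▸ List.suffix_rfl
  | e :: l, m, h => by
    have ih := suffix_of_mem_rises y l m
    rw [rises] at h
    split_ifs at h
    · rcases h with rfl | h
      · exact List.suffix_rfl
      · exact (ih h).trans (List.suffix_cons e l)
    · exact (ih h).trans (List.suffix_cons e l)
    · rw [Set.mem_singleton_iff] at h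
      exact h ▸ List.suffix_rfl

theorem rises_nonempty (y : Var) : ∀ l : History W, (rises y l).Nonempty
  | [] => ⟨[], rfl⟩
  | e :: l => by
    rw [rises]
    split_ifs
    · exact ⟨_, Set.mem_insert _ _⟩
    · exact rises_nonempty y l
    · exact ⟨_, rfl⟩

theorem eq_of_suffix_of_length_le {e : W × Label} {l m : History W} (h : e :: m <:+ l)
    (hl : l.length ≤ (e :: m).length) : l = e :: m :=
  (h.eq_of_length_le hl).symm

/-- Induction along the path that leads from the history `l` to the history `m` through the tree
of all histories: `l` and `m` are shortened until they coincide. If the two ends agree on `X` and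
are ordered for all `y ∈ Y`, then so is every transition on the way. -/
theorem path_induction {G : Set Formula} {T : W → Set Formula} {r : W} {X Y : Finset Var}
    {R : History W → History W → Prop} (refl : ∀ l, R l l)
    (fwd : ∀ l e m, Compat G (T (tip r m)) (T e.1) e.2 → X ⊆ e.2.X → Y ⊆ e.2.Y ∪ e.2.Z →
      (∀ y ∈ Y, y ∈ e.2.Z → ¬ rises y (e :: m) ⊆ rises y l) → R l m → R l (e :: m))
    (bwd : ∀ l e m, Compat G (T (tip r l)) (T e.1) e.2 → X ⊆ e.2.X → Y ⊆ e.2.Y →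
      (∀ y ∈ Y, rises y (e :: l) = rises y l) → R l m → R (e :: l) m) :
    ∀ l m : History W, Valid G T r l → Valid G T r m → (∀ x ∈ X, anchor x l = anchor x m) →
      (∀ y ∈ Y, rises y l ⊆ rises y m) → R l m := by
  intro l m
  induction hn : l.length + m.length using Nat.strong_induction_on generalizing l m with
  | _ n ih =>
  subst hn
  intro hl hm hX hY
  by_cases hlm : l = m
  · exact hlm ▸ refl l
  by_cases hle : l.length ≤ m.length
  · cases m with
    | nil => exact absurd (List.length_eq_zero_iff.1 (by simpa using hle)) hlm
    | cons e m =>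
      have hsuf : ∀ h : e :: m <:+ l, False := fun h =>
        hlm (eq_of_suffix_of_length_le h hle)
      have hX' : ∀ x ∈ X, x ∈ e.2.X ∧ anchor x l = anchor x m := by
        intro x hx
        have h := hX x hx
        rw [anchor] at h
        split_ifs at h with h'
        · exact ⟨h', h⟩
        · exact (hsuf (h ▸ anchor_suffix x l)).elim
      have hY' : ∀ y ∈ Y, y ∈ e.2.Y ∪ e.2.Z ∧ rises y l ⊆ rises y m := by
        intro y hy
        have h := hY y hy
        rw [rises] at h
        split_ifs at h with h₁ h₂
        · refine ⟨Finset.mem_union_right _ h₁, fun k hk => ?_⟩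
          rcases h hk with rfl | h
          · exact (hsuf (suffix_of_mem_rises y l _ hk)).elim
          · exact h
        · exact ⟨Finset.mem_union_left _ h₂, h⟩
        · obtain ⟨k, hk⟩ := rises_nonempty y l
          have hk' := h hk
          rw [Set.mem_singleton_iff] at hk'
          exact (hsuf (suffix_of_mem_rises y l _ (hk' ▸ hk))).elim
      refine fwd l e m hm.2 (fun x hx => (hX' x hx).1) (fun y hy => (hY' y hy).1) ?_
        (ih _ (by simp) l m rfl hl hm.1 (fun x hx => (hX' x hx).2) fun y hy => (hY' y hy).2)
      intro y _ hyZ hsub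
      refine hsuf (suffix_of_mem_rises y l _ (hsub ?_))
      rw [rises, if_pos hyZ]
      exact Set.mem_insert _ _
  · cases l with
    | nil => simp at hle
    | cons e l =>
      have hsuf : ∀ h : e :: l <:+ m, False := fun h => hle h.length_le
      have hX' : ∀ x ∈ X, x ∈ e.2.X ∧ anchor x l = anchor x m := by
        intro x hx
        have h := hX x hx
        rw [anchor] at h
        split_ifs at h with h'
        · exact ⟨h', h⟩
        · exact (hsuf (h ▸ anchor_suffix x m)).elim
      have hY' : ∀ y ∈ Y, y ∈ e.2.Y ∧ rises y (e :: l) = rises y l := by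
        intro y hy
        have h := hY y hy
        rw [rises] at h ⊢
        split_ifs at h ⊢ with h₁ h₂
        · exact (hsuf (suffix_of_mem_rises y m _ (h (Set.mem_insert _ _)))).elim
        · exact ⟨h₂, rfl⟩
        · exact (hsuf (suffix_of_mem_rises y m _ (h rfl))).elim
      exact bwd l e m hl.2 (fun x hx => (hX' x hx).1) (fun y hy => (hY' y hy).1)
        (fun y hy => (hY' y hy).2)
        (ih _ (by simp) l m rfl hl.1 hm (fun x hx => (hX' x hx).2)
          fun y hy => (hY' y hy).2 ▸ hY y hy)

end History

open History

section Unravel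

variable {G : Set Formula} {W : Type} {T : W → Set Formula} {r : W}

/-- Histories which agree on the variables of an atomic formula agree on that formula. -/
theorem atom_iff_of_agree {X : Finset Var} {φ : Formula} (hG : φ ∈ G) (hφ : AtomOver X φ)
    {l m : History W} (hl : Valid G T r l) (hm : Valid G T r m)
    (h : ∀ x ∈ X, anchor x l = anchor x m) : φ ∈ T (tip r l) ↔ φ ∈ T (tip r m) := by
  have mono : ∀ X', X ⊆ X' → AtomOver X' φ := by
    intro X' hX
    cases hφ with
    | atom P x h => exact .atom P x fun i => hX (h i)
    | dep Y z h => exact .dep Y z (h.trans hX)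
  refine path_induction (G := G) (T := T) (r := r) (X := X) (Y := ∅)
    (R := fun l m => φ ∈ T (tip r l) ↔ φ ∈ T (tip r m)) (fun _ => Iff.rfl) ?_ ?_ l m hl hm h
    (by simp)
  · intro l e m he hX _ _ ih
    exact ih.trans (he.atom φ hG (mono _ hX))
  · intro l e m he hX _ _ ih
    exact (he.atom φ hG (mono _ hX)).symm.trans ih

theorem anchor_eq_of_dep {Y : Finset Var} {z : Var} (hG : .dep Y z ∈ G) {l m : History W}
    (hl : Valid G T r l) (hm : Valid G T r m) (h : ∀ x ∈ Y, anchor x l = anchor x m)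
    (hd : .dep Y z ∈ T (tip r l)) : anchor z l = anchor z m := by
  have key : (.dep Y z ∈ T (tip r l) ↔ .dep Y z ∈ T (tip r m)) ∧
      (.dep Y z ∈ T (tip r l) → anchor z l = anchor z m) := by
    refine path_induction (G := G) (T := T) (r := r) (X := Y) (Y := ∅)
      (R := fun l m => (.dep Y z ∈ T (tip r l) ↔ .dep Y z ∈ T (tip r m)) ∧
        (.dep Y z ∈ T (tip r l) → anchor z l = anchor z m))
      (fun _ => ⟨Iff.rfl, fun _ => rfl⟩) ?_ ?_ l m hl hm h (by simp)
    · intro l e m he hX _ _ ih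
      have hat := he.atom _ hG (.dep Y z hX)
      refine ⟨ih.1.trans hat, fun hd => ?_⟩
      rw [ih.2 hd, anchor, if_pos (he.closed Y z hG hX (ih.1.1 hd))]
    · intro l e m he hX _ _ ih
      have hat := he.atom _ hG (.dep Y z hX)
      refine ⟨hat.symm.trans ih.1, fun hd => ?_⟩
      rw [anchor, if_pos (he.closed Y z hG hX (hat.2 hd)), ih.2 (hat.2 hd)]
  exact key.2 hd

open Classical in
/-- A box travels along the path from `l` to `m`, losing from its strict part exactly the variables
for which `m` is strictly better than `l`. -/
theorem box_transport {X Y Z : Finset Var} {φ : Formula} (hZ : Z ⊆ Y) {l m : History W}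
    (hl : Valid G T r l) (hm : Valid G T r m) (hX : ∀ x ∈ X, anchor x l = anchor x m)
    (hY : ∀ y ∈ Y, rises y l ⊆ rises y m) (h : .box X Y Z φ ∈ T (tip r l)) :
    .box X Y (Z.filter fun z => rises z m ⊆ rises z l) φ ∈ T (tip r m) := by
  refine path_induction (G := G) (T := T) (r := r) (X := X) (Y := Y)
    (R := fun l m => .box X Y Z φ ∈ T (tip r l) →
      .box X Y (Z.filter fun z => rises z m ⊆ rises z l) φ ∈ T (tip r m)) ?_ ?_ ?_ l m hl hm hX hY h
  · intro l h
    rwa [Finset.filter_true_of_mem fun z _ => subset_rfl]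
  · intro l e m he hX hY hstr ih h
    refine he.forward _ _ _ _ _ (ih h) hX hY ((Finset.filter_subset _ _).trans hZ) ?_ ?_
    · intro z hz
      rw [Finset.mem_filter] at hz ⊢
      refine ⟨hz.1, subset_trans ?_ hz.2⟩
      have hzY := hY (hZ hz.1)
      rw [rises]
      split_ifs with h₁ h₂
      · exact Set.subset_insert _ _
      · exact subset_rfl
      · simp [h₁, h₂] at hzY
    · intro z hz
      rw [Finset.mem_filter] at hz
      rw [Finset.mem_union, Finset.mem_filter]
      by_cases h₁ : z ∈ e.2.Z
      · exact Or.inr h₁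
      · have h₂ : z ∈ e.2.Y := (Finset.mem_union.1 (hY (hZ hz.1))).resolve_right h₁
        refine Or.inl ⟨hz.1, ?_⟩
        rw [rises, if_neg h₁, if_pos h₂]
        exact hz.2
  · intro l e m he hX hY heq ih h
    have := ih (he.backward _ _ _ _ h hX hY hZ)
    rwa [Finset.filter_congr fun z hz => by rw [heq z (hZ hz)]]

/-- The assignment at a history. Values carry their variable, so that distinct variables never
share a value. -/
def assign (l : History W) : Var → ULift.{u} (Var × History W) := fun x => ⟨(x, anchor x l)⟩

theorem assign_apply_eq {l m : History W} {x y : Var} :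
    assign.{u} l x = assign m y ↔ x = y ∧ anchor x l = anchor y m := by
  simp [assign, ULift.ext_iff]

/-- A transition keeps only finitely many variables, so every other one tells its end apart from
all earlier histories. -/
theorem assign_injective : Function.Injective (assign.{u} (W := W)) := by
  intro l m h
  let keep : History W → Finset Var := fun l => l.head?.elim ∅ fun e => e.2.X
  have hk : ∀ (l : History W) x, x ∉ keep l → anchor x l = l := by
    intro l x hx
    cases l with
    | nil => rfl
    | cons e l => exact if_neg hx
  obtain ⟨x, hx⟩ := Infinite.exists_notMem_finset (keep l ∪ keep m)
  rw [Finset.notMem_union] at hx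
  have := (assign_apply_eq.1 (congrFun h x)).2
  rwa [hk l x hx.1, hk m x hx.2] at this

variable (G T r) in
/-- The model whose admissible assignments are the valid histories. -/
noncomputable def unravel : PDModel.{u} where
  O := ULift (Var × History W)
  nonempty := ⟨⟨(0, [])⟩⟩
  I P := {f | ∃ (l : History W) (x : Fin (ar P) → Var), Valid G T r l ∧
    .atom P x ∈ T (tip r l) ∧ f = fun i => assign l (x i)}
  A := assign '' {l | Valid G T r l}
  pref y a b := rises y (Function.invFun assign a.1) ⊆ rises y (Function.invFun assign b.1)
  pref_refl _ _ := subset_rfl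
  pref_trans _ _ _ _ h h' := h.trans h'

/-- The point of the unravelled model given by a valid history. -/
def point (l : History W) (hl : Valid G T r l) : (unravel.{u} G T r).A := ⟨assign l, l, hl, rfl⟩

theorem forall_point {p : (unravel.{u} G T r).A → Prop} :
    (∀ a, p a) ↔ ∀ l hl, p (point l hl) :=
  ⟨fun h l hl => h _, by rintro h ⟨_, l, hl, rfl⟩; exact h l hl⟩

theorem agree_point {X : Finset Var} {l m : History W} {hl : Valid G T r l}
    {hm : Valid G T r m} : (unravel.{u} G T r).agree X (point l hl) (point m hm) ↔
      ∀ x ∈ X, anchor x l = anchor x m :=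
  forall₂_congr fun _ _ => assign_apply_eq.trans (and_iff_right rfl)

theorem pref_point {y : Var} {l m : History W} {hl : Valid G T r l}
    {hm : Valid G T r m} : (unravel.{u} G T r).pref y (point l hl) (point m hm) ↔
      rises y l ⊆ rises y m := by
  change rises y (Function.invFun assign.{u} (assign l)) ⊆
    rises y (Function.invFun assign.{u} (assign m)) ↔ _
  rw [Function.leftInverse_invFun assign_injective, Function.leftInverse_invFun assign_injective]

/-- The truth lemma for the unravelled model. -/
theorem unravel_sat_iff (hG : SubClosed G) (hT : Hintikka G T) {φ : Formula} (hφ : φ ∈ G)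
    {l : History W} (hl : Valid G T r l) :
    (unravel.{u} G T r).Sat (point l hl) φ ↔ φ ∈ T (tip r l) := by
  induction φ generalizing l with
  | atom P x =>
    constructor
    · rintro ⟨m, x', hm, hx', h⟩
      have h' : ∀ i, x i = x' i ∧ anchor (x i) l = anchor (x' i) m :=
        fun i => assign_apply_eq.1 (congrFun h i)
      obtain rfl : x = x' := funext fun i => (h' i).1
      refine (atom_iff_of_agree hφ (AtomOver.atom (X := Finset.univ.image x) P x (by simp))
        hl hm ?_).2 hx'
      simpa using fun i => (h' i).2
    · exact fun h => ⟨l, x, hl, h, rfl⟩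
  | dep X y =>
    simp only [PDModel.Sat, forall_point, agree_point]
    constructor
    · intro h
      by_contra hd
      obtain ⟨w', L, hL, hX, hy⟩ := hT.dep_witness _ _ _ hφ hd
      have hv : Valid G T r ((w', L) :: l) := ⟨hl, hL⟩
      have := (assign_apply_eq.1 (h _ hv fun x hx => by rw [anchor, if_pos (hX hx)])).2
      rw [anchor, if_neg hy] at this
      have hs := (anchor_suffix y l).length_le
      rw [this] at hs
      simp at hs
    · intro h m hm hlm
      exact assign_apply_eq.2 ⟨rfl, anchor_eq_of_dep hφ hl hm hlm h⟩
  | neg φ ih =>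
    rw [PDModel.Sat, ih (hG.neg φ hφ), hT.neg _ _ hφ]
  | and φ ψ ih₁ ih₂ =>
    rw [PDModel.Sat, ih₁ (hG.and φ ψ hφ).1, ih₂ (hG.and φ ψ hφ).2, hT.and _ _ _ hφ]
  | box X Y Z φ ih =>
    classical
    simp only [PDModel.Sat, forall_point, agree_point, PDModel.strict, pref_point,
      ih (hG.box _ _ _ _ hφ)]
    constructor
    · intro h
      by_contra hb
      obtain ⟨w', L, hL, hX, hY, hZ, hw⟩ := hT.box_witness _ _ _ _ _ hφ hb
      have hv : Valid G T r ((w', L) :: l) := ⟨hl, hL⟩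
      have hle : ∀ y ∈ L.Y ∪ L.Z, rises y l ⊆ rises y ((w', L) :: l) := by
        intro y hy
        rw [rises]
        split_ifs with h₁ h₂
        · exact Set.subset_insert _ _
        · exact subset_rfl
        · simp [h₁, h₂] at hy
      refine hw (h _ hv (fun x hx => by rw [anchor, if_pos (hX hx)])
        (fun y hy => hle y (hY hy))
        fun z hz => ⟨hle z (Finset.mem_union_right _ (hZ hz)), fun hz' => ?_⟩)
      have hm : (w', L) :: l ∈ rises z ((w', L) :: l) := by
        rw [rises, if_pos (hZ hz)]
        exact Set.mem_insert _ _
      have hs := (suffix_of_mem_rises z _ _ (hz' hm)).length_le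
      simp at hs
    · intro h m hm hX hY hZ
      have hbox := box_transport Finset.subset_union_right hl hm hX (fun y hy => ?_)
        (hT.norm _ _ _ _ _ hφ h)
      · rw [Finset.filter_false_of_mem fun z hz => (hZ z hz).2] at hbox
        exact hT.refl _ _ _ _ hbox
      · rcases Finset.mem_union.1 hy with hy | hy
        · exact hY y hy
        · exact (hZ y hy).1

/-- Every member of a type of a Hintikka system is satisfiable. -/
theorem Hintikka.satisfiable (hG : SubClosed G) (hT : Hintikka G T) {φ : Formula} (hφ : φ ∈ G)
    (h : φ ∈ T r) : Satisfiable.{u} φ :=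
  ⟨unravel G T r, point [] trivial, (unravel_sat_iff hG hT hφ _).2 h⟩

end Unravel

/-! ### Worlds: maximal consistent sets of the whole language -/

/-- A truth assignment to all formulas that respects negation and conjunction. -/
structure IsBoolean (v : Formula → Prop) : Prop where
  neg : ∀ φ, v (.neg φ) ↔ ¬ v φ
  and : ∀ φ ψ, v (.and φ ψ) ↔ v φ ∧ v ψ

namespace IsBoolean

variable {v : Formula → Prop}

theorem imp (hv : IsBoolean v) (φ ψ : Formula) : v (.imp φ ψ) ↔ (v φ → v ψ) := by
  rw [Formula.imp, hv.neg, hv.and, hv.neg]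
  tauto

theorem or (hv : IsBoolean v) (φ ψ : Formula) : v (.or φ ψ) ↔ v φ ∨ v ψ := by
  rw [Formula.or, hv.neg, hv.and, hv.neg, hv.neg]
  tauto

theorem not_bot (hv : IsBoolean v) : ¬ v .bot := by
  rw [Formula.bot, hv.and, hv.neg]
  tauto

theorem conj (hv : IsBoolean v) (l : List Formula) : v (.conj l) ↔ ∀ φ ∈ l, v φ := by
  induction l with
  | nil => simpa [Formula.conj, Formula.top, hv.neg] using hv.not_bot
  | cons φ l ih => simp [Formula.conj, hv.and, ih]

theorem disj (hv : IsBoolean v) (l : List Formula) : v (.disj l) ↔ ∃ φ ∈ l, v φ := by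
  induction l with
  | nil => simpa [Formula.disj] using hv.not_bot
  | cons φ l ih => simp [Formula.disj, hv.or, ih]

theorem depSet (hv : IsBoolean v) (X Y : Finset Var) :
    v (.depSet X Y) ↔ ∀ y ∈ Y, v (.dep X y) := by
  simp [Formula.depSet, hv.conj]

theorem dia (hv : IsBoolean v) (X Y Z : Finset Var) (φ : Formula) :
    v (.dia X Y Z φ) ↔ ¬ v (.box X Y Z (.neg φ)) :=
  hv.neg _

end IsBoolean

/-- The theorems of the calculus are closed under propositional consequence. -/
theorem Theorem.of_boolean (L : List Formula) {φ : Formula} (hL : ∀ ψ ∈ L, Theorem ψ)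
    (h : ∀ v, IsBoolean v → (∀ ψ ∈ L, v ψ) → v φ) : Theorem φ := by
  induction L generalizing φ with
  | nil => exact .taut fun v h₁ h₂ => h v ⟨h₁, h₂⟩ (by simp)
  | cons ψ L ih =>
    refine .mp (ih (φ := .imp ψ φ) (fun χ hχ => hL χ (List.mem_cons_of_mem _ hχ)) ?_)
      (hL ψ List.mem_cons_self)
    intro v hv hvL
    rw [hv.imp]
    exact fun hψ => h v hv (List.forall_mem_cons.2 ⟨hψ, hvL⟩)

theorem Derives.of_mem {Γ : Set Formula} {φ : Formula} (h : φ ∈ Γ) : Derives Γ φ := by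
  refine ⟨[φ], by simpa using h, .of_boolean [] (by simp) fun v hv _ => ?_⟩
  rw [hv.imp, hv.conj]
  exact fun h => h φ (by simp)

theorem Derives.of_theorem {Γ : Set Formula} {φ : Formula} (h : Theorem φ) : Derives Γ φ := by
  refine ⟨[], by simp, .of_boolean [φ] (by simpa using h) fun v hv hφ => ?_⟩
  rw [hv.imp]
  exact fun _ => hφ φ (by simp)

theorem Derives.of_boolean {Γ : Set Formula} (L : List Formula) {φ : Formula}
    (hL : ∀ ψ ∈ L, Derives Γ ψ) (h : ∀ v, IsBoolean v → (∀ ψ ∈ L, v ψ) → v φ) :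
    Derives Γ φ := by
  choose! l hl hl' using hL
  refine ⟨L.flatMap l, ?_, .of_boolean (L.map fun ψ => .imp (.conj (l ψ)) ψ) ?_ ?_⟩
  · intro ψ hψ
    obtain ⟨χ, hχ, hψ⟩ := List.mem_flatMap.1 hψ
    exact hl χ hχ ψ hψ
  · intro ψ hψ
    obtain ⟨χ, hχ, rfl⟩ := List.mem_map.1 hψ
    exact hl' χ hχ
  · intro v hv hvL
    rw [hv.imp, hv.conj]
    refine fun hvl => h v hv fun ψ hψ => ?_
    have := hvL _ (List.mem_map_of_mem hψ)
    rw [hv.imp, hv.conj] at this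
    exact this fun χ hχ => hvl χ (List.mem_flatMap.2 ⟨ψ, hψ, hχ⟩)

theorem Derives.neg_of_insert {Γ : Set Formula} {φ : Formula}
    (h : Derives (insert φ Γ) .bot) : Derives Γ (.neg φ) := by
  classical
  obtain ⟨l, hl, h⟩ := h
  refine ⟨l.filter (· ≠ φ), ?_, .of_boolean [_] (by simpa using h) ?_⟩
  · intro ψ hψ
    rw [List.mem_filter] at hψ
    exact (hl ψ hψ.1).resolve_left (by simpa using hψ.2)
  · intro v hv hvl
    have := hvl _ (List.mem_singleton_self _)
    rw [hv.imp, hv.conj] at this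
    rw [hv.imp, hv.conj, hv.neg]
    refine fun hvl hφ => hv.not_bot (this fun ψ hψ => ?_)
    by_cases hψφ : ψ = φ
    · exact hψφ ▸ hφ
    · exact hvl ψ (List.mem_filter.2 ⟨hψ, by simpa using hψφ⟩)

/-- A world is a truth assignment to all formulas under which all theorems of the calculus are
true, that is, the membership relation of a maximal consistent set of the whole language. -/
structure World (v : Formula → Prop) : Prop extends IsBoolean v where
  of_theorem : ∀ φ, Theorem φ → v φ

theorem World.of_derives {v : Formula → Prop} (hv : World v) {Γ : Set Formula} {φ : Formula}
    (hΓ : ∀ ψ ∈ Γ, v ψ) (h : Derives Γ φ) : v φ := by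
  obtain ⟨l, hl, h⟩ := h
  exact (hv.imp _ _).1 (hv.of_theorem _ h) ((hv.conj l).2 fun ψ hψ => hΓ ψ (hl ψ hψ))

/-- Lindenbaum's lemma. -/
theorem exists_world {Γ : Set Formula} (h : ¬ Derives Γ .bot) :
    ∃ v, World v ∧ ∀ φ ∈ Γ, v φ := by
  obtain ⟨Δ, hΓ, hΔ⟩ := zorn_subset_nonempty {Δ : Set Formula | ¬ Derives Δ .bot} (by
    intro c hc hchain hne
    refine ⟨⋃₀ c, ?_, fun s hs => Set.subset_sUnion_of_mem hs⟩
    rintro ⟨l, hl, hl'⟩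
    obtain ⟨t, ht, hlt⟩ := hchain.directedOn.exists_mem_subset_of_finite_of_subset_sUnion hne
      (s := {φ | φ ∈ l}) l.finite_toSet hl
    exact hc ht ⟨l, fun ψ hψ => hlt hψ, hl'⟩) Γ h
  have hcons : ¬ Derives Δ .bot := hΔ.prop
  have hneg : ∀ φ, φ ∉ Δ → Derives Δ (.neg φ) := by
    intro φ hφ
    refine .neg_of_insert (by_contra fun h => hφ ?_)
    exact hΔ.le_of_ge (y := insert φ Δ) h (Set.subset_insert _ _) (Set.mem_insert _ _)
  have hmem : ∀ φ, Derives Δ φ → φ ∈ Δ := by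
    intro φ hφ
    by_contra h
    refine hcons (.of_boolean [φ, .neg φ] (by simpa using ⟨hφ, hneg φ h⟩) fun v hv hvl => ?_)
    simp [hv.neg] at hvl
  refine ⟨(· ∈ Δ), ⟨⟨fun φ => ⟨fun h h' => ?_, fun h => hmem _ (hneg φ h)⟩, fun φ ψ =>
    ⟨fun h => ⟨hmem _ ?_, hmem _ ?_⟩, fun h => hmem _ ?_⟩⟩, fun φ h => hmem _ (.of_theorem h)⟩, hΓ⟩
  · refine hcons (.of_boolean [φ, .neg φ]
      (by simpa using ⟨Derives.of_mem h', Derives.of_mem h⟩) fun v hv hvl => ?_)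
    simp [hv.neg] at hvl
  · exact .of_boolean [_] (by simpa using Derives.of_mem h) fun v hv => by
      simpa [hv.and] using fun h _ => h
  · exact .of_boolean [_] (by simpa using Derives.of_mem h) fun v hv => by
      simp [hv.and]
  · exact .of_boolean [φ, ψ] (by simpa using ⟨Derives.of_mem h.1, Derives.of_mem h.2⟩)
      fun v hv => by simp [hv.and]

/-- Formulas true in all worlds are theorems. -/
theorem theorem_of_forall_world {φ : Formula} (h : ∀ v, World v → v φ) : Theorem φ := by
  by_contra hφ
  obtain ⟨v, hv, hv'⟩ := exists_world (Γ := {.neg φ}) fun ⟨l, hl, hl'⟩ => hφ (by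
    refine .of_boolean [_] (by simpa using hl') fun v hv hvl => ?_
    have := hvl _ (List.mem_singleton_self _)
    rw [hv.imp, hv.conj] at this
    by_contra hvφ
    refine hv.not_bot (this fun ψ hψ => ?_)
    rw [hl ψ hψ, hv.neg]
    exact hvφ)
  exact (hv.neg φ).1 (hv' _ rfl) (h v hv)

namespace World

variable {v : Formula → Prop}

theorem of_imp (hv : World v) {φ ψ : Formula} (h : Theorem (.imp φ ψ)) (hφ : v φ) : v ψ :=
  (hv.imp _ _).1 (hv.of_theorem _ h) hφ

theorem box_mono_body (hv : World v) {X Y Z : Finset Var} {φ ψ : Formula}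
    (h : ∀ v, World v → v φ → v ψ) (hb : v (.box X Y Z φ)) : v (.box X Y Z ψ) := by
  have hth : Theorem (.imp φ ψ) :=
    theorem_of_forall_world fun v hv => (hv.imp _ _).2 (h v hv)
  exact (hv.imp _ _).1 (hv.of_imp (.k X Y Z φ ψ) (hv.of_theorem _ (.nec X Y Z hth))) hb

theorem box_congr (hv : World v) {X Y Z : Finset Var} {φ ψ : Formula}
    (h : ∀ v, World v → (v φ ↔ v ψ)) : v (.box X Y Z φ) ↔ v (.box X Y Z ψ) :=
  ⟨hv.box_mono_body fun w hw => (h w hw).1, hv.box_mono_body fun w hw => (h w hw).2⟩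

theorem dia_neg (hv : World v) (X Y Z : Finset Var) (φ : Formula) :
    v (.dia X Y Z (.neg φ)) ↔ ¬ v (.box X Y Z φ) := by
  rw [hv.dia, not_iff_not]
  exact hv.box_congr fun w hw => by rw [hw.neg, hw.neg, not_not]

theorem dia_anti (hv : World v) {X Y Z X' Y' Z' : Finset Var} {φ : Formula} (hX : X ⊆ X')
    (hY : Y ⊆ Y') (hZ : Z ⊆ Z') (h : v (.dia X' Y' Z' φ)) : v (.dia X Y Z φ) := by
  rw [hv.dia] at h ⊢
  exact fun h' => h (hv.of_imp (.ordC _ hX hY hZ) h')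

end World

/-! ### Soundness and maximal consistent sets of the fragments -/

theorem isBoolean_sat (M : PDModel.{u}) (a : M.A) : IsBoolean (M.Sat a) :=
  ⟨fun _ => Iff.rfl, fun _ _ => Iff.rfl⟩

namespace PDModel

variable {M : PDModel.{u}}

theorem agree.symm {X : Finset Var} {a b : M.A} (h : M.agree X a b) : M.agree X b a :=
  fun x hx => (h x hx).symm

theorem agree.trans {X : Finset Var} {a b c : M.A} (h : M.agree X a b) (h' : M.agree X b c) :
    M.agree X a c :=
  fun x hx => (h x hx).trans (h' x hx)

theorem agree.mono {X X' : Finset Var} {a b : M.A} (hX : X ⊆ X') (h : M.agree X' a b) :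
    M.agree X a b :=
  fun x hx => h x (hX hx)

theorem strict.trans_pref {x : Var} {a b c : M.A} (h : M.strict x a b) (h' : M.pref x b c) :
    M.strict x a c :=
  ⟨M.pref_trans x a b c h.1 h', fun hca => h.2 (M.pref_trans x b c a h' hca)⟩

theorem strict.pref_trans {x : Var} {a b c : M.A} (h : M.pref x a b) (h' : M.strict x b c) :
    M.strict x a c :=
  ⟨M.pref_trans x a b c h h'.1, fun hca => h'.2 (M.pref_trans x c a b hca h)⟩

theorem sat_dia {a : M.A} {X Y Z : Finset Var} {φ : Formula} :
    M.Sat a (.dia X Y Z φ) ↔ ∃ b : M.A, M.agree X a b ∧ (∀ y ∈ Y, M.pref y a b) ∧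
      (∀ z ∈ Z, M.strict z a b) ∧ M.Sat b φ := by
  simp only [Formula.dia, Sat]
  push Not
  rfl

theorem sat_congr_of_atomOver {X : Finset Var} {φ : Formula} (hφ : AtomOver X φ) {a b : M.A}
    (h : M.agree X a b) : M.Sat a φ ↔ M.Sat b φ := by
  cases hφ with
  | atom P x hx =>
    simp only [Sat]
    rw [show (fun i => a.1 (x i)) = fun i => b.1 (x i) from funext fun i => h _ (hx i)]
  | dep Y z hY =>
    have key : ∀ a b : M.A, M.agree X a b → M.Sat a (.dep Y z) → M.Sat b (.dep Y z) := by
      intro a b hab h c hc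
      rw [← h b (hab.mono hY), h c ((hab.mono hY).trans hc)]
    exact ⟨key a b h, key b a h.symm⟩

/-- Diamonds compose, and a step is strict for a variable if one of its parts is. -/
theorem sat_dia_of_step {a b : M.A} {X Y Z X' Y' Z' : Finset Var} {φ : Formula}
    (hX : M.agree X a b) (hY : ∀ y ∈ Y, M.pref y a b) (hZ : ∀ z ∈ Z, M.strict z a b)
    (h : M.Sat b (.dia X' Y' Z' φ)) :
    M.Sat a (.dia (X ∩ X') (Y ∩ Y') ((Z ∩ Y') ∪ (Z ∩ Z') ∪ (Y ∩ Z')) φ) := by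
  obtain ⟨c, hX', hY', hZ', hc⟩ := sat_dia.1 h
  refine sat_dia.2 ⟨c,
    (hX.mono Finset.inter_subset_left).trans (hX'.mono Finset.inter_subset_right),
    fun y hy => ?_, fun z hz => ?_, hc⟩
  · rw [Finset.mem_inter] at hy
    exact M.pref_trans _ _ _ _ (hY y hy.1) (hY' y hy.2)
  · simp only [Finset.mem_union, Finset.mem_inter] at hz
    rcases hz with (hz | hz) | hz
    · exact (hZ z hz.1).trans_pref (hY' z hz.2)
    · exact (hZ z hz.1).trans_pref (hZ' z hz.2).1
    · exact .pref_trans (hY z hz.1) (hZ' z hz.2)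

end PDModel

/-- Soundness of the calculus. -/
theorem Theorem.sound {φ : Formula} (h : Theorem φ) (M : PDModel.{u}) (a : M.A) : M.Sat a φ := by
  induction h generalizing a with
  | taut h => exact h _ (isBoolean_sat M a).neg (isBoolean_sat M a).and
  | mp _ _ ih ih' => exact ((isBoolean_sat M a).imp _ _).1 (ih a) (ih' a)
  | nec X Y Z _ ih => exact fun b _ _ _ => ih b
  | k X Y Z φ ψ =>
    simp only [(isBoolean_sat M a).imp]
    intro h h' b hX hY hZ
    exact ((isBoolean_sat M b).imp _ _).1 (h b hX hY hZ) (h' b hX hY hZ)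
  | ordA X Y φ =>
    rw [(isBoolean_sat M a).imp]
    exact fun h => h a (fun _ _ => rfl) (fun y _ => M.pref_refl y a) (by simp)
  | ordB X Y Z X' Y' Z' φ =>
    rw [(isBoolean_sat M a).imp]
    intro h
    obtain ⟨b, hX, hY, hZ, h⟩ := PDModel.sat_dia.1 h
    exact PDModel.sat_dia_of_step hX hY hZ h
  | ordC φ hX hY hZ =>
    rw [(isBoolean_sat M a).imp]
    exact fun h b hX' hY' hZ' =>
      h b (hX'.mono hX) (fun y hy => hY' y (hY hy)) fun z hz => hZ' z (hZ hz)
  | ordD X Y Z φ =>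
    rw [(isBoolean_sat M a).imp]
    intro h
    obtain ⟨b, hX, hY, hZ, h⟩ := PDModel.sat_dia.1 h
    refine PDModel.sat_dia.2 ⟨b, hX, fun y hy => ?_, hZ, h⟩
    rcases Finset.mem_union.1 hy with hy | hy
    · exact hY y hy
    · exact (hZ y hy).1
  | ordE X Y Z φ ψ =>
    have hv := isBoolean_sat M a
    rw [hv.imp, hv.and, hv.or, hv.disj]
    rintro ⟨hφ, h⟩
    obtain ⟨b, hX, hY, hZ, h⟩ := PDModel.sat_dia.1 h
    by_cases hba : ∀ y ∈ Y, M.pref y b a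
    · exact Or.inl (PDModel.sat_dia.2 ⟨b, hX, hY, hZ, h,
        PDModel.sat_dia.2 ⟨a, hX.symm, hba, by simp, hφ⟩⟩)
    · push Not at hba
      obtain ⟨y, hy, hba⟩ := hba
      refine Or.inr ⟨_, List.mem_map_of_mem ((Finset.mem_sort _).2 hy),
        PDModel.sat_dia.2 ⟨b, hX, hY, fun z hz => ?_, h⟩⟩
      rcases Finset.mem_union.1 hz with hz | hz
      · exact hZ z hz
      · rw [Finset.mem_singleton.1 hz]
        exact ⟨hY y hy, hba⟩
  | depA X =>
    rw [(isBoolean_sat M a).depSet]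
    exact fun y hy b hb => hb y hy
  | depB h =>
    rw [(isBoolean_sat M a).imp]
    exact fun hφ b hb _ _ => (PDModel.sat_congr_of_atomOver h hb).1 hφ
  | depC X S T =>
    have hv := isBoolean_sat M a
    rw [hv.imp, hv.and, hv.depSet, hv.depSet, hv.depSet]
    exact fun h y hy b hb => h.2 y hy b fun s hs => h.1 s hs b hb
  | depD X S Y Z φ =>
    have hv := isBoolean_sat M a
    rw [hv.imp, hv.and, hv.depSet]
    exact fun h b hX hY hZ => h.2 b (fun s hs => h.1 s hs b hX) hY hZ

theorem world_sat (M : PDModel.{u}) (a : M.A) : World (M.Sat a) :=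
  { isBoolean_sat M a with of_theorem := fun _ h => h.sound M a }

theorem neg_mem_fragment {α φ : Formula} : .neg φ ∈ Fragment α ↔ φ ∈ Fragment α :=
  Iff.rfl

theorem subClosed_fragment (α : Formula) : SubClosed (Fragment α) where
  neg _ h := h
  and φ ψ h := by
    simp only [Fragment, Set.mem_ofPred_eq, Formula.vars, Formula.preds, Formula.degree,
      Finset.union_subset_iff, max_le_iff] at h ⊢
    tauto
  box X Y Z φ h := by
    simp only [Fragment, Set.mem_ofPred_eq, Formula.vars, Formula.preds, Formula.degree,
      Finset.union_subset_iff] at h ⊢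
    exact ⟨h.1.2, h.2.1, by omega⟩

theorem box_mem_fragment {α φ : Formula} {X Y Z X' Y' Z' : Finset Var}
    (h : .box X Y Z φ ∈ Fragment α) (hX : X' ⊆ α.vars) (hY : Y' ⊆ α.vars) (hZ : Z' ⊆ α.vars) :
    .box X' Y' Z' φ ∈ Fragment α := by
  simp only [Fragment, Set.mem_ofPred_eq, Formula.vars, Formula.preds, Formula.degree,
    Finset.union_subset_iff] at h ⊢
  exact ⟨⟨⟨⟨hX, hY⟩, hZ⟩, h.1.2⟩, h.2⟩

theorem dia_neg_mem_fragment {α φ : Formula} {X Y Z : Finset Var} :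
    .dia X Y Z (.neg φ) ∈ Fragment α ↔ .box X Y Z φ ∈ Fragment α :=
  Iff.rfl

theorem dia_mem_fragment {α φ : Formula} {X Y Z X' Y' Z' : Finset Var}
    (h : .box X Y Z φ ∈ Fragment α) (hX : X' ⊆ α.vars) (hY : Y' ⊆ α.vars) (hZ : Z' ⊆ α.vars) :
    .dia X' Y' Z' (.neg φ) ∈ Fragment α :=
  dia_neg_mem_fragment.2 (box_mem_fragment h hX hY hZ)

theorem subset_vars_of_box_mem_fragment {α φ : Formula} {X Y Z : Finset Var}
    (h : .box X Y Z φ ∈ Fragment α) : X ⊆ α.vars ∧ Y ⊆ α.vars ∧ Z ⊆ α.vars := by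
  simp only [Fragment, Set.mem_ofPred_eq, Formula.vars, Finset.union_subset_iff] at h
  tauto

/-- The part of a world that lies in the fragment of `α` is a maximal consistent set. -/
theorem World.isMCS {v : Formula → Prop} (hv : World v) (α : Formula) :
    IsMCS α {φ | φ ∈ Fragment α ∧ v φ} := by
  refine ⟨fun φ h => h.1, fun h => hv.not_bot (hv.of_derives (fun φ h => h.2) h), ?_⟩
  intro Γ' hΓ hΓ'
  obtain ⟨φ, hφ, hφ'⟩ := Set.exists_of_ssubset hΓ
  have hn : .neg φ ∈ Γ' := hΓ.1 ⟨neg_mem_fragment.2 (hΓ' hφ), (hv.neg φ).2 fun h => hφ' ⟨hΓ' hφ, h⟩⟩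
  refine .of_boolean [φ, .neg φ] (by simpa using ⟨Derives.of_mem hφ, Derives.of_mem hn⟩) ?_
  intro v hv hvl
  simp [hv.neg] at hvl

/-- Every maximal consistent set of the fragment of `α` is the part of a world in the fragment. -/
theorem IsMCS.exists_world {α : Formula} {Δ : Set Formula} (h : IsMCS α Δ) :
    ∃ v, World v ∧ ∀ φ ∈ Fragment α, φ ∈ Δ ↔ v φ := by
  obtain ⟨v, hv, hΔ⟩ := LPFD.exists_world h.2.1
  refine ⟨v, hv, fun φ hφ => ⟨hΔ φ, fun hvφ => by_contra fun hn => ?_⟩⟩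
  refine hv.not_bot (hv.of_derives ?_ (h.2.2 (insert φ Δ) (Set.ssubset_insert hn)
    (Set.insert_subset hφ h.1)))
  rintro ψ (rfl | hψ)
  · exact hvφ
  · exact hΔ ψ hψ

/-! ### Pre-models and satisfiability -/

/-- The sets of formulas of the fragment true at the points of a model form a pre-model. -/
theorem isPreModel_of_model (α : Formula) (M : PDModel.{u}) :
    IsPreModel α (Set.range fun a : M.A => {φ | φ ∈ Fragment α ∧ M.Sat a φ}) := by
  refine ⟨?_, ?_⟩
  · rintro _ ⟨a, rfl⟩
    exact (world_sat M a).isMCS α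
  rintro X Y Z hX hY hZ _ ⟨a, rfl⟩ φ ⟨⟨hF, hφ⟩, hsat, -⟩
  obtain ⟨b, hXb, hYb, hZb, hb⟩ := PDModel.sat_dia.1 hφ
  have hF' : φ.vars ⊆ α.vars ∧ φ.preds ⊆ α.preds ∧ φ.degree + 1 ≤ α.degree := by
    simpa [Fragment, Formula.dia, Formula.vars, Formula.preds, Formula.degree,
      Finset.union_subset_iff, hX, hY, hZ] using hF
  -- saturation says that no variable in `Y` can be improved strictly on the way to `b`
  have hba : ∀ y ∈ Y, M.pref y b a := by
    intro y hy
    by_contra hn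
    refine hsat y hy ⟨?_, PDModel.sat_dia.2 ⟨b, hXb, hYb, fun z hz => ?_, hb⟩⟩
    · simpa [Fragment, Formula.dia, Formula.vars, Formula.preds, Formula.degree,
        Finset.insert_subset_iff, Finset.union_subset_iff, hX, hY, hZ, hY hy] using hF'
    · rcases Finset.mem_union.1 hz with hz | hz
      · exact hZb z hz
      · rw [Finset.mem_singleton.1 hz]
        exact ⟨hYb y hy, hn⟩
  refine ⟨_, ⟨b, rfl⟩, ?_, ⟨⟨hF'.1, hF'.2.1, by omega⟩, hb⟩, ?_⟩
  · rintro X' Y' Z' ψ ⟨-, hψ⟩ hψF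
    refine ⟨hψF, ?_⟩
    convert PDModel.sat_dia_of_step hXb hYb hZb hψ using 2
    ext z
    simp only [Finset.mem_union, Finset.mem_inter]
    tauto
  · rintro X' Y' Z' ψ ⟨-, hψ⟩ hψF
    refine ⟨hψF, ?_⟩
    convert PDModel.sat_dia_of_step hXb.symm hba (Z := ∅) (by simp) hψ using 2
    ext z
    simp only [Finset.mem_union, Finset.mem_inter]
    tauto

theorem self_mem_fragment (α : Formula) : α ∈ Fragment α :=
  ⟨subset_rfl, subset_rfl, le_rfl⟩

/-- A true diamond can be sharpened to one to which no variable can be added on the strict side,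
and which is therefore saturated. -/
theorem World.exists_saturated {v : Formula → Prop} (hv : World v) {X : Finset Var} {φ : Formula}
    (Y Z : Finset Var) (h : v (.dia X Y Z φ)) :
    ∃ Y' Z', Y' ⊆ Y ∧ Z' ⊆ Y ∪ Z ∧ Y ⊆ Y' ∪ Z' ∧ Z ⊆ Z' ∧ Y' ∩ Z' = ∅ ∧ v (.dia X Y' Z' φ) ∧
      ∀ y ∈ Y', ¬ v (.dia X Y' (Z' ∪ {y}) φ) := by
  induction hn : (Y \ Z).card generalizing Z with
  | zero =>
    rw [Finset.card_eq_zero, Finset.sdiff_eq_empty_iff_subset] at hn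
    exact ⟨∅, Z, by simp, Finset.subset_union_right, by simpa using hn, subset_rfl, by simp,
      hv.dia_anti subset_rfl (by simp) subset_rfl h, by simp⟩
  | succ n ih =>
    by_cases hs : ∀ y ∈ Y \ Z, ¬ v (.dia X (Y \ Z) (Z ∪ {y}) φ)
    · refine ⟨Y \ Z, Z, Finset.sdiff_subset, Finset.subset_union_right, by simp, subset_rfl,
        by simp, hv.dia_anti subset_rfl Finset.sdiff_subset subset_rfl h, hs⟩
    · push Not at hs
      obtain ⟨y, hy, hvy⟩ := hs
      have hy' := Finset.mem_sdiff.1 hy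
      have h' : v (.dia X Y (Z ∪ {y}) φ) := by
        refine hv.dia_anti subset_rfl ?_ subset_rfl (hv.of_imp (.ordD _ _ _ _) hvy)
        intro x hx
        simp only [Finset.mem_union, Finset.mem_sdiff]
        tauto
      obtain ⟨Y', Z', h₁, h₂, h₃, h₄, h₅⟩ := ih (Z ∪ {y}) h' (by
        have he : Y \ (Z ∪ {y}) = (Y \ Z).erase y := by
          ext x
          simp only [Finset.mem_sdiff, Finset.mem_union, Finset.mem_singleton, Finset.mem_erase]
          tauto
        rw [he, Finset.card_erase_of_mem hy, hn, Nat.add_sub_cancel])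
      refine ⟨Y', Z', h₁, h₂.trans ?_, h₃, Finset.subset_union_left.trans h₄, h₅⟩
      intro x
      simp only [Finset.mem_union, Finset.mem_singleton]
      rintro (hx | hx | rfl)
      exacts [Or.inl hx, Or.inr hx, Or.inl hy'.1]

/-- In a world, the variables of `V` that depend on `Y`. -/
noncomputable def dependents (v : Formula → Prop) (V Y : Finset Var) : Finset Var :=
  open Classical in V.filter fun x => v (.dep Y x)

theorem mem_dependents {v : Formula → Prop} {V Y : Finset Var} {x : Var} :
    x ∈ dependents v V Y ↔ x ∈ V ∧ v (.dep Y x) := by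
  classical exact Finset.mem_filter

theorem World.dep_self {v : Formula → Prop} (hv : World v) {X : Finset Var} {x : Var}
    (hx : x ∈ X) : v (.dep X x) :=
  (hv.depSet X X).1 (hv.of_theorem _ (.depA X)) x hx

theorem World.subset_dependents {v : Formula → Prop} (hv : World v) {V Y : Finset Var}
    (hY : Y ⊆ V) : Y ⊆ dependents v V Y :=
  fun _ hy => mem_dependents.2 ⟨hY hy, hv.dep_self hy⟩

/-- Dependence is transitive, so the set of dependents is closed under it. -/
theorem World.mem_dependents_of_dep {v : Formula → Prop} (hv : World v) {V X Y : Finset Var}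
    {z : Var} (hY : Y ⊆ dependents v V X) (h : v (.dep Y z)) (hz : z ∈ V) :
    z ∈ dependents v V X := by
  refine mem_dependents.2 ⟨hz, (hv.depSet X {z}).1 (hv.of_imp (.depC X Y {z}) ?_) z (by simp)⟩
  rw [hv.and, hv.depSet, hv.depSet]
  exact ⟨fun y hy => (mem_dependents.1 (hY hy)).2, by simpa using h⟩

/-- The maximal consistent sets of a pre-model form a Hintikka system. -/
theorem IsPreModel.hintikka {α : Formula} {F : Set (Set Formula)} (hF : IsPreModel α F) :
    Hintikka (Fragment α) (fun Δ : F => Δ.1) := by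
  have hval : ∀ Δ : F, ∃ v, World v ∧ ∀ φ ∈ Fragment α, φ ∈ Δ.1 ↔ v φ :=
    fun Δ => (hF.1 Δ.1 Δ.2).exists_world
  choose v hv hΔv using hval
  have hsub : ∀ Δ : F, Δ.1 ⊆ Fragment α := fun Δ => (hF.1 Δ.1 Δ.2).1
  have hdep : ∀ Y z, .dep Y z ∈ Fragment α → Y ⊆ α.vars ∧ z ∈ α.vars := by
    intro Y z h
    have := h.1
    rw [Formula.vars, Finset.insert_subset_iff] at this
    exact this.symm
  refine ⟨fun Δ φ hφ => ?_, fun Δ φ ψ hφ => ?_, fun Δ X Y φ hφ => ?_, fun Δ X Y Z φ hφ h => ?_,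
    fun Δ Y z hd hn => ?_, fun Δ X Y Z φ hφ hn => ?_⟩
  · rw [hΔv _ _ hφ, (hv Δ).neg, hΔv _ _ ((subClosed_fragment α).neg _ hφ)]
  · have := (subClosed_fragment α).and _ _ hφ
    rw [hΔv _ _ hφ, (hv Δ).and, hΔv _ _ this.1, hΔv _ _ this.2]
  · have hf := hsub Δ hφ
    rw [hΔv _ _ hf] at hφ
    exact (hΔv _ _ ((subClosed_fragment α).box _ _ _ _ hf)).2 ((hv Δ).of_imp (.ordA X Y φ) hφ)
  · rw [hΔv _ _ hφ] at h
    refine (hΔv _ _ ?_).2 ((hv Δ).of_imp (.ordC φ subset_rfl Finset.subset_union_left subset_rfl) h)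
    obtain ⟨h₁, h₂, h₃⟩ := subset_vars_of_box_mem_fragment hφ
    exact box_mem_fragment hφ h₁ (Finset.union_subset h₂ h₃) h₃
  · -- a copy of `Δ` in which only the variables that depend on `Y` keep their values
    rw [hΔv _ _ hd] at hn
    refine ⟨Δ, ⟨dependents (v Δ) α.vars Y, ∅, ∅⟩, ⟨fun _ _ _ => Iff.rfl, ?_, ?_, ?_⟩,
      (hv Δ).subset_dependents (hdep _ _ hd).1, fun h => hn (mem_dependents.1 h).2⟩
    · intro Y' z' hG hY' h
      exact (hv Δ).mem_dependents_of_dep hY' ((hΔv _ _ hG).1 h) (hdep _ _ hG).2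
    · intro X' Y' Z' Z'' φ h _ _ _ hZ hZ'
      rwa [hZ.antisymm (by simpa using hZ')]
    · exact fun _ _ _ _ h _ _ _ => h
  · obtain ⟨hXα, hYα, hZα⟩ := subset_vars_of_box_mem_fragment hφ
    rw [hΔv _ _ hφ] at hn
    -- close `X` under dependence, then saturate
    set X₁ := dependents (v Δ) α.vars X with hX₁
    have hX₁α : X₁ ⊆ α.vars := fun x hx => (mem_dependents.1 hx).1
    have hd₁ : v Δ (.dia X₁ Y Z (.neg φ)) := by
      rw [(hv Δ).dia_neg]
      refine fun h => hn ((hv Δ).of_imp (.depD X X₁ Y Z φ) ?_)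
      rw [(hv Δ).and, (hv Δ).depSet]
      exact ⟨fun x hx => (mem_dependents.1 hx).2, h⟩
    obtain ⟨Y₁, Z₁, hY₁, hZ₁, hYs, hZs, hdisj, hd₂, hsat⟩ := (hv Δ).exists_saturated Y Z hd₁
    have hY₁α := hY₁.trans hYα
    have hZ₁α := hZ₁.trans (Finset.union_subset hYα hZα)
    obtain ⟨Θ, hΘ, hR, hφΘ, hR'⟩ := hF.2 X₁ Y₁ Z₁ hX₁α hY₁α hZ₁α Δ.1 Δ.2 (.neg φ)
      ⟨(hΔv _ _ (dia_mem_fragment (φ := φ) hφ hX₁α hY₁α hZ₁α)).2 hd₂, fun y hy h =>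
        hsat y hy ((hΔv _ _ (hsub _ h)).1 h), hdisj⟩
    lift Θ to F using hΘ
    have hφF := (subClosed_fragment α).box _ _ _ _ hφ
    refine ⟨Θ, ⟨X₁, Y₁, Z₁⟩, ⟨?_, ?_, ?_, ?_⟩, (hv Δ).subset_dependents hXα, hYs, hZs, ?_⟩
    · -- an atomic formula over `X₁` that changed its truth value would give a diamond at
      -- the other end
      have key : ∀ (Δ Θ : F) (Y Z : Finset Var), Rp α X₁ Y Z Δ.1 Θ.1 → ∀ ψ ∈ Fragment α,
          AtomOver X₁ ψ → ψ ∈ Δ.1 → ψ ∈ Θ.1 := by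
        intro Δ Θ Y Z hR ψ hψ hat h
        by_contra hn
        rw [hΔv _ _ hψ] at h hn
        have hF' : .dia X₁ ∅ ∅ (.neg ψ) ∈ Fragment α := by
          have h₁ : ψ.degree = 0 := by cases hat <;> rfl
          -- the fragment contains a box, so it has room for this diamond
          have h₂ : 0 < α.degree := by
            have := hφ.2.2
            rw [Formula.degree] at this
            omega
          refine ⟨?_, hψ.2.1, ?_⟩
          · simpa [Formula.dia, Formula.vars, Finset.union_subset_iff] using ⟨hX₁α, hψ.1⟩
          · change ψ.degree + 1 ≤ α.degree
            omega
        have h₁ := hR X₁ ∅ ∅ (.neg ψ) ((hΔv Θ _ hF').2 (((hv Θ).dia_neg _ _ _ _).2 fun h' =>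
          hn ((hv Θ).of_imp (.ordA X₁ ∅ ψ) (by simpa using h')))) (by simpa using hF')
        simp only [Finset.inter_self, Finset.inter_empty, Finset.empty_inter,
          Finset.union_empty] at h₁
        exact ((hv Δ).dia_neg _ _ _ _).1 ((hΔv Δ _ hF').1 h₁) ((hv Δ).of_imp (.depB hat) h)
      exact fun ψ hψ hat => ⟨key Δ Θ Y₁ Z₁ hR ψ hψ hat, key Θ Δ Y₁ ∅ hR' ψ hψ hat⟩
    · intro Y' z' hG hY' h
      exact (hv Δ).mem_dependents_of_dep hY' ((hΔv _ _ hG).1 h) (hdep _ _ hG).2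
    · intro X' Y' Z' Z'' ψ h hX' hY' hZY hZ' hZ''
      have hf := hsub _ h
      obtain ⟨h₁, h₂, h₃⟩ := subset_vars_of_box_mem_fragment hf
      have hf' : .dia X' Y' Z'' (.neg ψ) ∈ Fragment α :=
        dia_mem_fragment (φ := ψ) hf h₁ h₂ (hZ'.trans h₃)
      by_contra hn
      rw [hΔv _ _ (dia_neg_mem_fragment.1 hf'), ← (hv Θ).dia_neg, ← hΔv _ _ hf'] at hn
      have := hR _ _ _ _ hn (dia_mem_fragment (φ := ψ) hf
        (Finset.inter_subset_right.trans h₁) (Finset.inter_subset_right.trans h₂) ?_)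
      · -- strict variables may be added on the weak side, which restores all of `Y'`
        rw [hΔv _ _ (hsub _ this)] at this
        refine ((hv Δ).dia_neg _ _ _ _).1 ?_ ((hΔv _ _ hf).1 h)
        refine (hv Δ).dia_anti ?_ ?_ ?_ ((hv Δ).of_imp (.ordD _ _ _ _) this)
        · exact Finset.subset_inter hX' subset_rfl
        · intro y hy
          have := hY' hy
          simp only [Finset.mem_union, Finset.mem_inter] at this ⊢
          tauto
        · intro z hz
          have h₁ := hZY hz
          have h₂ := hY' (hZY hz)
          have h₃ := hZ'' hz
          simp only [Finset.mem_union, Finset.mem_inter] at h₂ h₃ ⊢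
          tauto
      · refine Finset.union_subset (Finset.union_subset ?_ ?_) ?_
        · exact Finset.inter_subset_right.trans h₂
        · exact Finset.inter_subset_right.trans hY₁α
        · exact Finset.inter_subset_left.trans hZ₁α
    · intro X' Y' Z' ψ h hX' hY' hZY
      have hf := hsub _ h
      obtain ⟨h₁, h₂, h₃⟩ := subset_vars_of_box_mem_fragment hf
      have hf' : .dia X' Y' Z' (.neg ψ) ∈ Fragment α := dia_mem_fragment (φ := ψ) hf h₁ h₂ h₃
      by_contra hn
      rw [hΔv _ _ hf, ← (hv Δ).dia_neg, ← hΔv _ _ hf'] at hn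
      have := hR' _ _ _ _ hn
      simp only [Finset.inter_eq_right.2 hX', Finset.inter_eq_right.2 hY', Finset.empty_inter,
        Finset.empty_union, Finset.union_empty, Finset.inter_eq_left.2 (hZY.trans hY')] at this
      exact ((hv Θ).dia_neg _ _ _ _).1 ((hΔv _ _ hf').1 (this hf')) ((hΔv _ _ hf).1 h)
    · rw [hΔv _ _ (neg_mem_fragment.2 hφF), (hv Θ).neg, ← hΔv _ _ hφF] at hφΘ
      exact hφΘ

/-- A formula is satisfiable if and only if it is satisfied in a pre-model. -/
theorem satisfiable_iff_exists_preModel (α : Formula) :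
    Satisfiable.{u} α ↔ ∃ F : Set (Set Formula), IsPreModel α F ∧ SatisfiedIn F α := by
  constructor
  · rintro ⟨M, a, h⟩
    exact ⟨_, isPreModel_of_model α M, _, ⟨a, rfl⟩, self_mem_fragment α, h⟩
  · rintro ⟨F, hF, Δ, hΔ, hα⟩
    exact hF.hintikka.satisfiable (r := ⟨Δ, hΔ⟩) (subClosed_fragment α) (self_mem_fragment α) hα

/-! ### Finiteness of the fragments -/

/-- The truth values of the formulas of `B` determine those of the formulas of `K` in all
worlds. -/
def Determines (B K : Set Formula) : Prop :=
  ∀ φ ∈ K, ∀ v w, World v → World w → (∀ ψ ∈ B, v ψ ↔ w ψ) → (v φ ↔ w φ)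

/-- If a finite set determines `K`, then `K` is finite up to equivalence: a formula of `K` is given
by the truth assignments to the finite set that make it true. -/
theorem Determines.exists_finite_representatives {B K : Set Formula} (hB : B.Finite)
    (h : Determines B K) :
    ∃ S ⊆ K, S.Finite ∧ ∀ φ ∈ K, ∃ ψ ∈ S, ∀ v, World v → (v φ ↔ v ψ) := by
  let f : Formula → Set (Set Formula) := fun φ =>
    {b | ∃ v, World v ∧ v φ ∧ b = {ψ | ψ ∈ B ∧ v ψ}}
  have hf : ∀ φ ψ, ψ ∈ K → f φ = f ψ → ∀ v, World v → v φ → v ψ := by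
    intro φ ψ hψ hφψ v hv hvφ
    have hm : {χ | χ ∈ B ∧ v χ} ∈ f φ := ⟨v, hv, hvφ, rfl⟩
    rw [hφψ] at hm
    obtain ⟨w, hw, hwψ, hvw⟩ := hm
    refine (h ψ hψ v w hv hw fun χ hχ => ?_).2 hwψ
    have := Set.ext_iff.1 hvw χ
    simp only [Set.mem_ofPred_eq] at this
    tauto
  obtain ⟨S, hS, hbij⟩ := Set.exists_subset_bijOn K f
  refine ⟨S, hS, hbij.finite_iff_finite.2 ?_, fun φ hφ => ?_⟩
  · refine hB.finite_subsets.finite_subsets.subset ?_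
    rintro _ ⟨φ, -, rfl⟩ _ ⟨v, -, -, rfl⟩
    exact fun χ hχ => hχ.1
  · obtain ⟨ψ, hψ, he⟩ := hbij.surjOn ⟨φ, hφ, rfl⟩
    exact ⟨ψ, hψ, fun v hv => ⟨hf φ ψ (hS hψ) he.symm v hv, hf ψ φ hφ he v hv⟩⟩

/-- The formulas over given variables and predicate symbols of bounded modal degree. -/
def Bounded (V : Finset Var) (Q : Finset Pred) (d : ℕ) : Set Formula :=
  {φ | φ.vars ⊆ V ∧ φ.preds ⊆ Q ∧ φ.degree ≤ d}

/-- The atomic formulas over given variables and predicate symbols. -/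
def Atomic (V : Finset Var) (Q : Finset Pred) : Set Formula :=
  (⋃ P ∈ Q, Set.range fun x : Fin (ar P) → V => .atom P fun i => x i) ∪
    (fun p : Finset Var × Var => .dep p.1 p.2) '' (V.powerset ×ˢ V : Finset _)

theorem finite_atomic (V : Finset Var) (Q : Finset Pred) : (Atomic V Q).Finite :=
  (Q.finite_toSet.biUnion fun _ _ => Set.finite_range _).union ((Finset.finite_toSet _).image _)

/-- Formulas are Boolean combinations of atomic formulas and boxes. -/
theorem determines_of_boxes {V : Finset Var} {Q : Finset Pred} {d : ℕ} {C : Set Formula}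
    (hC : ∀ X Y Z φ, .box X Y Z φ ∈ Bounded V Q d →
      ∃ ψ ∈ C, ∀ v, World v → (v (.box X Y Z φ) ↔ v ψ)) :
    Determines (Atomic V Q ∪ C) (Bounded V Q d) := by
  intro φ hφ v w hv hw h
  induction φ with
  | atom P x =>
    simp only [Bounded, Set.mem_ofPred_eq, Formula.vars, Formula.preds,
      Finset.singleton_subset_iff] at hφ
    refine h _ (Or.inl (Or.inl (Set.mem_biUnion (Finset.mem_coe.2 hφ.2.1)
      ⟨fun i => ⟨x i, hφ.1 ?_⟩, rfl⟩)))
    simp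
  | dep X y =>
    simp only [Bounded, Set.mem_ofPred_eq, Formula.vars, Finset.insert_subset_iff] at hφ
    exact h _ (Or.inl (Or.inr ⟨(X, y), by simp [hφ], rfl⟩))
  | neg φ ih => rw [hv.neg, hw.neg, ih hφ]
  | and φ ψ ih₁ ih₂ =>
    simp only [Bounded, Set.mem_ofPred_eq, Formula.vars, Formula.preds, Formula.degree,
      Finset.union_subset_iff, max_le_iff] at hφ
    rw [hv.and, hw.and, ih₁ ⟨hφ.1.1, hφ.2.1.1, hφ.2.2.1⟩, ih₂ ⟨hφ.1.2, hφ.2.1.2, hφ.2.2.2⟩]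
  | box X Y Z φ ih =>
    obtain ⟨ψ, hψ, he⟩ := hC X Y Z φ hφ
    rw [he v hv, he w hw, h ψ (Or.inr hψ)]

/-- By induction on the degree, there are only finitely many boxes up to equivalence. -/
theorem exists_finite_boxes (V : Finset Var) (Q : Finset Pred) (d : ℕ) :
    ∃ C : Set Formula, C.Finite ∧ ∀ X Y Z φ, .box X Y Z φ ∈ Bounded V Q d →
      ∃ ψ ∈ C, ∀ v, World v → (v (.box X Y Z φ) ↔ v ψ) := by
  induction d with
  | zero => exact ⟨∅, Set.finite_empty, fun X Y Z φ h => by simp [Bounded, Formula.degree] at h⟩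
  | succ d ih =>
    obtain ⟨C, hC, hbox⟩ := ih
    obtain ⟨S, -, hS, hrep⟩ := (determines_of_boxes hbox).exists_finite_representatives
      ((finite_atomic V Q).union hC)
    refine ⟨(fun p : (Finset Var × Finset Var × Finset Var) × Formula =>
      .box p.1.1 p.1.2.1 p.1.2.2 p.2) ''
        ((V.powerset ×ˢ V.powerset ×ˢ V.powerset : Finset _) ×ˢ S),
      ((Finset.finite_toSet _).prod hS).image _, fun X Y Z φ h => ?_⟩
    simp only [Bounded, Set.mem_ofPred_eq, Formula.vars, Formula.preds, Formula.degree,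
      Finset.union_subset_iff, add_le_add_iff_right] at h
    obtain ⟨ψ, hψ, he⟩ := hrep φ ⟨h.1.2, h.2⟩
    exact ⟨_, ⟨((X, Y, Z), ψ), by simp [h, hψ], rfl⟩, fun v hv => hv.box_congr he⟩

theorem exists_finite_determines_fragment (α : Formula) :
    ∃ B : Set Formula, B.Finite ∧ Determines B (Fragment α) :=
  let ⟨_, hC, h⟩ := exists_finite_boxes α.vars α.preds α.degree
  ⟨_, (finite_atomic _ _).union hC, determines_of_boxes h⟩

theorem exists_finite_fragment_representatives (α : Formula) :
    ∃ S : Set Formula, S.Finite ∧ S ⊆ Fragment α ∧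
      ∀ φ ∈ Fragment α, ∃ ψ ∈ S, Equivalent.{u} φ ψ := by
  obtain ⟨B, hB, h⟩ := exists_finite_determines_fragment α
  obtain ⟨S, hSF, hS, hrep⟩ := h.exists_finite_representatives hB
  refine ⟨S, hS, hSF, fun φ hφ => ?_⟩
  obtain ⟨ψ, hψ, he⟩ := hrep φ hφ
  exact ⟨ψ, hψ, fun M a => he _ (world_sat M a)⟩

theorem finite_setOf_isMCS (α : Formula) : {Γ : Set Formula | IsMCS α Γ}.Finite := by
  obtain ⟨B, hB, h⟩ := exists_finite_determines_fragment α
  refine (hB.finite_subsets.image fun b =>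
    {φ | φ ∈ Fragment α ∧ ∃ v, World v ∧ b = {ψ | ψ ∈ B ∧ v ψ} ∧ v φ}).subset ?_
  intro Γ hΓ
  have hΓ : IsMCS α Γ := hΓ
  obtain ⟨v, hv, hΓv⟩ := hΓ.exists_world
  refine ⟨{ψ | ψ ∈ B ∧ v ψ}, fun ψ hψ => hψ.1, Set.ext fun φ => ⟨?_, fun hφ => ?_⟩⟩
  · rintro ⟨hφ, w, hw, hvw, hwφ⟩
    refine (hΓv φ hφ).2 ((h φ hφ v w hv hw fun χ hχ => ?_).2 hwφ)
    have := Set.ext_iff.1 hvw χ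
    simp only [Set.mem_ofPred_eq] at this
    tauto
  · have hF : φ ∈ Fragment α := hΓ.1 hφ
    exact ⟨hF, v, hv, rfl, (hΓv φ hF).1 hφ⟩

/-! ### Arithmetical certificates of satisfiability -/

/-- The number `i` belongs to the finite set with bit mask `c`. -/
def MaskMem (i c : ℕ) : Prop := c / 2 ^ i % 2 = 1

/-- Inclusion of the finite sets given by bit masks. -/
def MaskSub (c d : ℕ) : Prop := ∀ i < c, MaskMem i c → MaskMem i d

/-- Inclusion of a finite set in the union of two others, all given by bit masks. -/
def MaskSubUnion (c d e : ℕ) : Prop := ∀ i < c, MaskMem i c → MaskMem i d ∨ MaskMem i e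

/-- The number of the constructor at the root of a formula, read off from the Gödel number. -/
def codeTag (m : ℕ) : ℕ := m.unpair.1

/-- The formula below a negation. -/
def codeArg (m : ℕ) : ℕ := m.unpair.2

/-- The left half of the data below the root of a formula. -/
def codeLeft (m : ℕ) : ℕ := m.unpair.2.unpair.1

/-- The right half of the data below the root of a formula. -/
def codeRight (m : ℕ) : ℕ := m.unpair.2.unpair.2

/-- The Gödel number of a box. -/
def boxCode (X Y Z m : ℕ) : ℕ := Nat.pair 4 (Nat.pair (Nat.pair X Y) (Nat.pair Z m))

/-- The mask of `X` in the Gödel number of `⟦X, Y, Z⟧ φ`. -/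
def boxX (m : ℕ) : ℕ := (codeLeft m).unpair.1

/-- The mask of `Y` in the Gödel number of `⟦X, Y, Z⟧ φ`. -/
def boxY (m : ℕ) : ℕ := (codeLeft m).unpair.2

/-- The mask of `Z` in the Gödel number of `⟦X, Y, Z⟧ φ`. -/
def boxZ (m : ℕ) : ℕ := (codeRight m).unpair.1

/-- The Gödel number of `φ` in the Gödel number of `⟦X, Y, Z⟧ φ`. -/
def boxBody (m : ℕ) : ℕ := (codeRight m).unpair.2

/-- All members of the list with number `c` belong to the set with mask `X`. -/
def ListIn (c X : ℕ) : Prop := ∀ x ∈ Denumerable.ofNat (List ℕ) c, MaskMem x X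

/-- `g` is the mask of a set of Gödel numbers of formulas closed under immediate subformulas. -/
def CodesClosed (g : ℕ) : Prop :=
  ∀ m < g, MaskMem m g →
    (codeTag m = 0 ∧
        (Denumerable.ofNat (List ℕ) (codeRight m)).length = (codeLeft m).unpair.1) ∨
      codeTag m = 1 ∨
      (codeTag m = 2 ∧ MaskMem (codeArg m) g) ∨
      (codeTag m = 3 ∧ MaskMem (codeLeft m) g ∧ MaskMem (codeRight m) g) ∨
      (codeTag m = 4 ∧ MaskMem (boxBody m) g)

/-- The arithmetical form of `AtomOver`. -/
def CodeAtomOver (X m : ℕ) : Prop :=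
  (codeTag m = 0 ∧ ListIn (codeRight m) X) ∨ (codeTag m = 1 ∧ MaskSub (codeLeft m) X)

/-- The arithmetical form of `Compat`, for types given as masks of sets of Gödel numbers. -/
def CodeCompat (g t s X Y Z : ℕ) : Prop :=
  (∀ m < g, MaskMem m g → CodeAtomOver X m → (MaskMem m t ↔ MaskMem m s)) ∧
  (∀ m < g, MaskMem m g → codeTag m = 1 → MaskSub (codeLeft m) X → MaskMem m t →
    MaskMem (codeRight m) X) ∧
  (∀ m < t, MaskMem m t → codeTag m = 4 → MaskSub (boxX m) X → MaskSubUnion (boxY m) Y Z →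
    MaskSub (boxZ m) (boxY m) → ∀ z < boxZ m + 1, MaskSub z (boxZ m) → MaskSubUnion (boxZ m) z Z →
      MaskMem (boxCode (boxX m) (boxY m) z (boxBody m)) s) ∧
  (∀ m < s, MaskMem m s → codeTag m = 4 → MaskSub (boxX m) X → MaskSub (boxY m) Y →
    MaskSub (boxZ m) (boxY m) → MaskMem m t)

/-- The arithmetical form of the conditions on a single type in a Hintikka system. -/
def CodeLocal (g t : ℕ) : Prop :=
  (∀ m < g, MaskMem m g → codeTag m = 2 → (MaskMem m t ↔ ¬ MaskMem (codeArg m) t)) ∧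
  (∀ m < g, MaskMem m g → codeTag m = 3 →
    (MaskMem m t ↔ MaskMem (codeLeft m) t ∧ MaskMem (codeRight m) t)) ∧
  (∀ m < t, MaskMem m t → codeTag m = 4 → boxZ m = 0 → MaskMem (boxBody m) t) ∧
  (∀ m < g, MaskMem m g → MaskMem m t → codeTag m = 4 → ∀ y < boxY m + boxZ m + 1,
    MaskSub (boxY m) y → MaskSub (boxZ m) y → MaskSubUnion y (boxY m) (boxZ m) →
      MaskMem (boxCode (boxX m) y (boxZ m) (boxBody m)) t)

/-- The arithmetical form of the witness conditions in a Hintikka system; the masks of the labels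
are bounded by `b`. -/
def CodeWitnessed (b g f t : ℕ) : Prop :=
  (∀ m < g, MaskMem m g → codeTag m = 1 → ¬ MaskMem m t →
    ∃ s < f, MaskMem s f ∧ ∃ X < b, ∃ Y < b, ∃ Z < b, CodeCompat g t s X Y Z ∧
      MaskSub (codeLeft m) X ∧ ¬ MaskMem (codeRight m) X) ∧
  (∀ m < g, MaskMem m g → codeTag m = 4 → ¬ MaskMem m t →
    ∃ s < f, MaskMem s f ∧ ∃ X < b, ∃ Y < b, ∃ Z < b, CodeCompat g t s X Y Z ∧
      MaskSub (boxX m) X ∧ MaskSubUnion (boxY m) Y Z ∧ MaskSub (boxZ m) Z ∧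
        ¬ MaskMem (boxBody m) s)

/-- A bound for the Gödel numbers that occur in types for the formula with Gödel number `n`. -/
def codeBound (n : ℕ) : ℕ := boxCode n (n + n) n n + 1

/-- There is a Hintikka system, with bounded code, for the formula with Gödel number `n`. -/
def HasCertificate (n : ℕ) : Prop :=
  ∃ g < 2 ^ (n + 1), ∃ f < 2 ^ 2 ^ codeBound n, CodesClosed g ∧ MaskMem n g ∧
    (∃ t < f, MaskMem t f ∧ MaskMem n t) ∧
    ∀ t < f, MaskMem t f → CodeLocal g t ∧ CodeWitnessed (2 ^ (n + 1)) g f t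

/-! ### Certificates are primitive recursive -/

section Primrec

variable {α : Type} [Primcodable α]

theorem primrecPred_forall_lt {f : α → ℕ} {p : α → ℕ → Prop} (hf : Primrec f)
    (hp : PrimrecPred fun q : α × ℕ => p q.1 q.2) : PrimrecPred fun a => ∀ i < f a, p a i :=
  ((PrimrecRel.forall_mem_list (R := fun i (a : α) => p a i)
    (hp.comp (Primrec.pair Primrec.snd Primrec.fst))).comp
      (Primrec.list_range.comp hf) Primrec.id).of_eq (by simp)

theorem primrecPred_exists_lt {f : α → ℕ} {p : α → ℕ → Prop} (hf : Primrec f)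
    (hp : PrimrecPred fun q : α × ℕ => p q.1 q.2) : PrimrecPred fun a => ∃ i < f a, p a i :=
  ((PrimrecRel.exists_mem_list (R := fun i (a : α) => p a i)
    (hp.comp (Primrec.pair Primrec.snd Primrec.fst))).comp
      (Primrec.list_range.comp hf) Primrec.id).of_eq (by simp)

theorem primrecPred_imp {p q : α → Prop} (hp : PrimrecPred p) (hq : PrimrecPred q) :
    PrimrecPred fun a => p a → q a :=
  (hp.not.or hq).of_eq fun _ => imp_iff_not_or.symm

theorem primrecPred_iff {p q : α → Prop} (hp : PrimrecPred p) (hq : PrimrecPred q) :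
    PrimrecPred fun a => p a ↔ q a :=
  ((primrecPred_imp hp hq).and (primrecPred_imp hq hp)).of_eq fun _ => iff_def.symm

theorem primrec_pow {f g : α → ℕ} (hf : Primrec f) (hg : Primrec g) :
    Primrec fun a => f a ^ g a :=
  (Primrec₂.unpaired'.1 Nat.Primrec.pow).comp hf hg

theorem primrec_add {f g : α → ℕ} (hf : Primrec f) (hg : Primrec g) :
    Primrec fun a => f a + g a :=
  Primrec.nat_add.comp hf hg

theorem primrec_codeTag {f : α → ℕ} (hf : Primrec f) : Primrec fun a => codeTag (f a) :=
  Primrec.fst.comp (Primrec.unpair.comp hf)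

theorem primrec_codeArg {f : α → ℕ} (hf : Primrec f) : Primrec fun a => codeArg (f a) :=
  Primrec.snd.comp (Primrec.unpair.comp hf)

theorem primrec_codeLeft {f : α → ℕ} (hf : Primrec f) : Primrec fun a => codeLeft (f a) :=
  primrec_codeTag (primrec_codeArg hf)

theorem primrec_codeRight {f : α → ℕ} (hf : Primrec f) : Primrec fun a => codeRight (f a) :=
  primrec_codeArg (primrec_codeArg hf)

theorem primrec_boxX {f : α → ℕ} (hf : Primrec f) : Primrec fun a => boxX (f a) :=
  primrec_codeTag (primrec_codeLeft hf)

theorem primrec_boxY {f : α → ℕ} (hf : Primrec f) : Primrec fun a => boxY (f a) :=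
  primrec_codeArg (primrec_codeLeft hf)

theorem primrec_boxZ {f : α → ℕ} (hf : Primrec f) : Primrec fun a => boxZ (f a) :=
  primrec_codeTag (primrec_codeRight hf)

theorem primrec_boxBody {f : α → ℕ} (hf : Primrec f) : Primrec fun a => boxBody (f a) :=
  primrec_codeArg (primrec_codeRight hf)

theorem primrec_boxCode {f g h k : α → ℕ} (hf : Primrec f) (hg : Primrec g) (hh : Primrec h)
    (hk : Primrec k) : Primrec fun a => boxCode (f a) (g a) (h a) (k a) :=
  Primrec₂.natPair.comp (.const 4)
    (Primrec₂.natPair.comp (Primrec₂.natPair.comp hf hg) (Primrec₂.natPair.comp hh hk))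

theorem primrecPred_maskMem {f g : α → ℕ} (hf : Primrec f) (hg : Primrec g) :
    PrimrecPred fun a => MaskMem (f a) (g a) :=
  Primrec.eq.comp (Primrec.nat_mod.comp (Primrec.nat_div.comp hg (primrec_pow (.const 2) hf))
    (.const 2)) (.const 1)

theorem primrecPred_maskSub {f g : α → ℕ} (hf : Primrec f) (hg : Primrec g) :
    PrimrecPred fun a => MaskSub (f a) (g a) :=
  primrecPred_forall_lt hf (primrecPred_imp
    (primrecPred_maskMem .snd (hf.comp .fst)) (primrecPred_maskMem .snd (hg.comp .fst)))

theorem primrecPred_maskSubUnion {f g h : α → ℕ} (hf : Primrec f) (hg : Primrec g)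
    (hh : Primrec h) : PrimrecPred fun a => MaskSubUnion (f a) (g a) (h a) :=
  primrecPred_forall_lt hf (primrecPred_imp
    (primrecPred_maskMem .snd (hf.comp .fst)) (.or (primrecPred_maskMem .snd (hg.comp .fst))
      (primrecPred_maskMem .snd (hh.comp .fst))))

theorem primrecPred_listIn {f g : α → ℕ} (hf : Primrec f) (hg : Primrec g) :
    PrimrecPred fun a => ListIn (f a) (g a) :=
  (PrimrecRel.forall_mem_list (R := MaskMem) (primrecPred_maskMem .fst .snd)).comp
    ((Primrec.ofNat (List ℕ)).comp hf) hg

theorem primrecPred_codesClosed {g : α → ℕ} (hg : Primrec g) :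
    PrimrecPred fun a => CodesClosed (g a) := by
  have hg' : Primrec fun q : α × ℕ => g q.1 := hg.comp .fst
  have hm : Primrec fun q : α × ℕ => q.2 := .snd
  have htag : ∀ i, PrimrecPred fun q : α × ℕ => codeTag q.2 = i := fun i =>
    Primrec.eq.comp (primrec_codeTag hm) (.const i)
  refine primrecPred_forall_lt hg (primrecPred_imp (primrecPred_maskMem hm hg') ?_)
  refine .or (.and (htag 0) ?_) (.or (htag 1) (.or (.and (htag 2) ?_)
    (.or (.and (htag 3) (.and ?_ ?_)) (.and (htag 4) ?_))))
  · exact Primrec.eq.comp (Primrec.list_length.comp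
      ((Primrec.ofNat (List ℕ)).comp (primrec_codeRight hm)))
        (primrec_codeTag (primrec_codeLeft hm))
  · exact primrecPred_maskMem (primrec_codeArg hm) hg'
  · exact primrecPred_maskMem (primrec_codeLeft hm) hg'
  · exact primrecPred_maskMem (primrec_codeRight hm) hg'
  · exact primrecPred_maskMem (primrec_boxBody hm) hg'

/-- The proof follows the syntax of the condition: connectives and bounded quantifiers first, then
the terms and the projections to the bound variables. -/
theorem primrecPred_codeCompat {g t s X Y Z : α → ℕ} (hg : Primrec g) (ht : Primrec t)
    (hs : Primrec s) (hX : Primrec X) (hY : Primrec Y) (hZ : Primrec Z) :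
    PrimrecPred fun a => CodeCompat (g a) (t a) (s a) (X a) (Y a) (Z a) := by
  unfold CodeCompat CodeAtomOver
  repeat' first
    | with_reducible refine PrimrecPred.and ?_ ?_
    | with_reducible refine PrimrecPred.or ?_ ?_
    | with_reducible refine primrecPred_forall_lt ?_ ?_
    | with_reducible refine primrecPred_iff ?_ ?_
    | with_reducible refine primrecPred_imp ?_ ?_
    | with_reducible refine primrecPred_maskMem ?_ ?_
    | with_reducible refine primrecPred_maskSub ?_ ?_
    | with_reducible refine primrecPred_maskSubUnion ?_ ?_ ?_
    | with_reducible refine primrecPred_listIn ?_ ?_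
    | with_reducible refine Primrec.eq.comp ?_ ?_
    | with_reducible exact Primrec.const _
    | with_reducible exact Primrec.fst
    | with_reducible exact Primrec.snd
    | with_reducible assumption
    | with_reducible refine primrec_boxCode ?_ ?_ ?_ ?_
    | with_reducible refine primrec_add ?_ ?_
    | with_reducible refine primrec_codeTag ?_
    | with_reducible refine primrec_codeLeft ?_
    | with_reducible refine primrec_codeRight ?_
    | with_reducible refine primrec_boxX ?_
    | with_reducible refine primrec_boxY ?_
    | with_reducible refine primrec_boxZ ?_
    | with_reducible refine primrec_boxBody ?_
    | with_reducible refine Primrec.fst.comp ?_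
    | with_reducible refine Primrec.snd.comp ?_
    | with_reducible refine hg.comp ?_
    | with_reducible refine ht.comp ?_
    | with_reducible refine hs.comp ?_
    | with_reducible refine hX.comp ?_
    | with_reducible refine hY.comp ?_
    | with_reducible refine hZ.comp ?_

theorem primrecPred_codeLocal {g t : α → ℕ} (hg : Primrec g) (ht : Primrec t) :
    PrimrecPred fun a => CodeLocal (g a) (t a) := by
  unfold CodeLocal
  repeat' first
    | with_reducible refine PrimrecPred.and ?_ ?_
    | with_reducible refine PrimrecPred.not ?_
    | with_reducible refine primrecPred_forall_lt ?_ ?_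
    | with_reducible refine primrecPred_iff ?_ ?_
    | with_reducible refine primrecPred_imp ?_ ?_
    | with_reducible refine primrecPred_maskMem ?_ ?_
    | with_reducible refine primrecPred_maskSub ?_ ?_
    | with_reducible refine primrecPred_maskSubUnion ?_ ?_ ?_
    | with_reducible refine Primrec.eq.comp ?_ ?_
    | with_reducible exact Primrec.const _
    | with_reducible exact Primrec.fst
    | with_reducible exact Primrec.snd
    | with_reducible assumption
    | with_reducible refine primrec_boxCode ?_ ?_ ?_ ?_
    | with_reducible refine primrec_add ?_ ?_
    | with_reducible refine primrec_codeTag ?_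
    | with_reducible refine primrec_codeLeft ?_
    | with_reducible refine primrec_codeRight ?_
    | with_reducible refine primrec_codeArg ?_
    | with_reducible refine primrec_boxX ?_
    | with_reducible refine primrec_boxY ?_
    | with_reducible refine primrec_boxZ ?_
    | with_reducible refine primrec_boxBody ?_
    | with_reducible refine Primrec.fst.comp ?_
    | with_reducible refine Primrec.snd.comp ?_
    | with_reducible refine hg.comp ?_
    | with_reducible refine ht.comp ?_

theorem primrecPred_codeWitnessed {b g f t : α → ℕ} (hb : Primrec b) (hg : Primrec g)
    (hf : Primrec f) (ht : Primrec t) :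
    PrimrecPred fun a => CodeWitnessed (b a) (g a) (f a) (t a) := by
  unfold CodeWitnessed
  repeat' first
    | with_reducible refine PrimrecPred.and ?_ ?_
    | with_reducible refine PrimrecPred.not ?_
    | with_reducible refine primrecPred_forall_lt ?_ ?_
    | with_reducible refine primrecPred_exists_lt ?_ ?_
    | with_reducible refine primrecPred_imp ?_ ?_
    | with_reducible refine primrecPred_maskMem ?_ ?_
    | with_reducible refine primrecPred_maskSub ?_ ?_
    | with_reducible refine primrecPred_maskSubUnion ?_ ?_ ?_
    | with_reducible refine Primrec.eq.comp ?_ ?_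
    | with_reducible refine primrecPred_codeCompat ?_ ?_ ?_ ?_ ?_ ?_
    | with_reducible exact Primrec.const _
    | with_reducible exact Primrec.fst
    | with_reducible exact Primrec.snd
    | with_reducible assumption
    | with_reducible refine primrec_codeTag ?_
    | with_reducible refine primrec_codeLeft ?_
    | with_reducible refine primrec_codeRight ?_
    | with_reducible refine primrec_boxX ?_
    | with_reducible refine primrec_boxY ?_
    | with_reducible refine primrec_boxZ ?_
    | with_reducible refine primrec_boxBody ?_
    | with_reducible refine Primrec.fst.comp ?_
    | with_reducible refine Primrec.snd.comp ?_
    | with_reducible refine hb.comp ?_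
    | with_reducible refine hg.comp ?_
    | with_reducible refine hf.comp ?_
    | with_reducible refine ht.comp ?_

end Primrec

theorem primrecPred_hasCertificate : PrimrecPred HasCertificate := by
  have hb : Primrec fun n : ℕ => 2 ^ (n + 1) := primrec_pow (.const 2) .succ
  have hK : Primrec fun n : ℕ => 2 ^ 2 ^ codeBound n :=
    primrec_pow (.const 2) (primrec_pow (.const 2) (Primrec.succ.comp
      (primrec_boxCode .id (primrec_add .id .id) .id .id)))
  have hn : Primrec fun q : (ℕ × ℕ) × ℕ => q.1.1 := Primrec.fst.comp .fst
  have hg : Primrec fun q : (ℕ × ℕ) × ℕ => q.1.2 := Primrec.snd.comp .fst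
  have hf : Primrec fun q : (ℕ × ℕ) × ℕ => q.2 := .snd
  have ht : Primrec fun q : ((ℕ × ℕ) × ℕ) × ℕ => q.2 := .snd
  refine primrecPred_exists_lt hb (primrecPred_exists_lt (hK.comp .fst) ?_)
  refine .and (primrecPred_codesClosed hg) (.and (primrecPred_maskMem hn hg) (.and ?_ ?_))
  · exact primrecPred_exists_lt hf (.and (primrecPred_maskMem ht (hf.comp .fst))
      (primrecPred_maskMem (hn.comp .fst) ht))
  · exact primrecPred_forall_lt hf (primrecPred_imp (primrecPred_maskMem ht (hf.comp .fst))
      (.and (primrecPred_codeLocal (hg.comp .fst) ht) (primrecPred_codeWitnessed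
        ((hb.comp hn).comp .fst) (hg.comp .fst) (hf.comp .fst) ht)))

/-! ### From certificates to Hintikka systems -/

open Formula (codeSet)

theorem maskMem_iff {i c : ℕ} : MaskMem i c ↔ i ∈ c.bitIndices := by
  rw [Nat.mem_bitIndices, Nat.testBit_eq_decide_div_mod_eq, decide_eq_true_iff, MaskMem]

@[simp]
theorem maskMem_codeSet {i : ℕ} {X : Finset ℕ} : MaskMem i (codeSet X) ↔ i ∈ X := by
  rw [maskMem_iff, ← List.mem_toFinset, codeSet, Finset.toFinset_bitIndices_sum_two_pow]

theorem codeSet_surjective : Function.Surjective codeSet :=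
  fun c => ⟨c.bitIndices.toFinset, Finset.sum_toFinset_bitIndices_two_pow c⟩

theorem MaskMem.lt {i c : ℕ} (h : MaskMem i c) : i < c :=
  i.lt_two_pow_self.trans_le (Nat.two_pow_le_of_mem_bitIndices (maskMem_iff.1 h))

theorem codeSet_le_of_subset {X Y : Finset ℕ} (h : X ⊆ Y) : codeSet X ≤ codeSet Y :=
  Finset.sum_le_sum_of_subset h

theorem codeSet_union_le (X Y : Finset ℕ) : codeSet (X ∪ Y) ≤ codeSet X + codeSet Y := by
  rw [codeSet, codeSet, codeSet, ← Finset.sum_union_inter]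
  exact Nat.le_add_right _ _

theorem codeSet_lt {X : Finset ℕ} {n : ℕ} (h : ∀ i ∈ X, i < n) : codeSet X < 2 ^ n :=
  Nat.geomSum_lt le_rfl h

@[simp]
theorem maskSub_codeSet {X Y : Finset ℕ} : MaskSub (codeSet X) (codeSet Y) ↔ X ⊆ Y := by
  constructor
  · exact fun h i hi => maskMem_codeSet.1 (h i (maskMem_codeSet.2 hi).lt (maskMem_codeSet.2 hi))
  · exact fun h i _ hi => maskMem_codeSet.2 (h (maskMem_codeSet.1 hi))

@[simp]
theorem maskSubUnion_codeSet {X Y Z : Finset ℕ} :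
    MaskSubUnion (codeSet X) (codeSet Y) (codeSet Z) ↔ X ⊆ Y ∪ Z := by
  simp only [MaskSubUnion, maskMem_codeSet, ← Finset.mem_union]
  exact ⟨fun h i hi => h i (maskMem_codeSet.2 hi).lt hi, fun h i _ hi => h hi⟩

@[simp]
theorem listIn_encode {k : ℕ} {x : Fin k → ℕ} {X : ℕ} :
    ListIn (Encodable.encode (List.ofFn x)) X ↔ ∀ i, MaskMem (x i) X := by
  simp [ListIn]

section Code

open Formula

variable (P : Pred) (x : Fin (ar P) → Var) (X Y Z : Finset Var) (y : Var) (φ ψ : Formula)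

@[simp] theorem codeTag_atom : codeTag (atom P x).code = 0 := by simp [codeTag, code]

@[simp] theorem codeTag_dep : codeTag (dep X y).code = 1 := by simp [codeTag, code]

@[simp] theorem codeTag_neg : codeTag (neg φ).code = 2 := by simp [codeTag, code]

@[simp] theorem codeTag_and : codeTag (and φ ψ).code = 3 := by simp [codeTag, code]

@[simp] theorem codeTag_box : codeTag (box X Y Z φ).code = 4 := by simp [codeTag, code]

@[simp] theorem codeLeft_atom : codeLeft (atom P x).code = Nat.pair P.1 P.2 := by
  simp [codeLeft, code]

@[simp] theorem codeRight_atom :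
    codeRight (atom P x).code = Encodable.encode (List.ofFn x) := by simp [codeRight, code]

@[simp] theorem codeLeft_dep : codeLeft (dep X y).code = codeSet X := by simp [codeLeft, code]

@[simp] theorem codeRight_dep : codeRight (dep X y).code = y := by simp [codeRight, code]

@[simp] theorem codeArg_neg : codeArg (neg φ).code = φ.code := by simp [codeArg, code]

@[simp] theorem codeLeft_and : codeLeft (and φ ψ).code = φ.code := by simp [codeLeft, code]

@[simp] theorem codeRight_and : codeRight (and φ ψ).code = ψ.code := by simp [codeRight, code]

@[simp] theorem boxX_box : boxX (box X Y Z φ).code = codeSet X := by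
  simp [boxX, codeLeft, code]

@[simp] theorem boxY_box : boxY (box X Y Z φ).code = codeSet Y := by
  simp [boxY, codeLeft, code]

@[simp] theorem boxZ_box : boxZ (box X Y Z φ).code = codeSet Z := by
  simp [boxZ, codeRight, code]

@[simp] theorem boxBody_box : boxBody (box X Y Z φ).code = φ.code := by
  simp [boxBody, codeRight, code]

@[simp] theorem boxCode_code :
    boxCode (codeSet X) (codeSet Y) (codeSet Z) φ.code = (box X Y Z φ).code := rfl

@[simp] theorem codeAtomOver_code :
    CodeAtomOver (codeSet X) φ.code ↔ AtomOver X φ := by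
  cases φ with
  | atom P x =>
    simp only [CodeAtomOver, codeTag_atom, codeRight_atom, listIn_encode, maskMem_codeSet,
      true_and, zero_ne_one, false_and, or_false]
    exact ⟨fun h => .atom P x h, fun h => by cases h; assumption⟩
  | dep Y z =>
    simp only [CodeAtomOver, codeTag_dep, codeLeft_dep, maskSub_codeSet, one_ne_zero,
      true_and, false_and, false_or]
    exact ⟨fun h => .dep Y z h, fun h => by cases h; assumption⟩
  | neg φ => exact ⟨fun h => by simp [CodeAtomOver] at h, fun h => by cases h⟩
  | and φ ψ => exact ⟨fun h => by simp [CodeAtomOver] at h, fun h => by cases h⟩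
  | box X Y Z φ => exact ⟨fun h => by simp [CodeAtomOver] at h, fun h => by cases h⟩

end Code

/-- The set of formulas whose Gödel numbers belong to the set with mask `t`. -/
def maskFormulas (t : ℕ) : Set Formula := {φ | MaskMem φ.code t}

@[simp]
theorem mem_maskFormulas {t : ℕ} {φ : Formula} : φ ∈ maskFormulas t ↔ MaskMem φ.code t :=
  Iff.rfl

/-- The tag conditions at all members make every member decode to a formula. -/
theorem exists_formula_of_codesClosed {g : ℕ} (hg : CodesClosed g) {m : ℕ} (hm : MaskMem m g) :
    ∃ φ : Formula, φ.code = m := by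
  induction m using Nat.strong_induction_on with
  | _ m ih =>
  have h₁ : Nat.pair (codeTag m) (codeArg m) = m := Nat.pair_unpair m
  have h₂ : Nat.pair (codeLeft m) (codeRight m) = codeArg m := Nat.pair_unpair _
  have h₃ : Nat.pair (boxX m) (boxY m) = codeLeft m := Nat.pair_unpair _
  have h₄ : Nat.pair (boxZ m) (boxBody m) = codeRight m := Nat.pair_unpair _
  have hlt := Nat.add_le_pair (codeTag m) (codeArg m)
  have hl := Nat.left_le_pair (codeLeft m) (codeRight m)
  have hr := Nat.right_le_pair (codeLeft m) (codeRight m)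
  have hb := Nat.right_le_pair (boxZ m) (boxBody m)
  rcases hg m hm.lt hm with ⟨h, hlen⟩ | h | ⟨h, ha⟩ | ⟨h, ha, ha'⟩ | ⟨h, ha⟩
  · generalize hL : Denumerable.ofNat (List ℕ) (codeRight m) = L at hlen
    have hL' : Encodable.encode L = codeRight m := by rw [← hL, Denumerable.encode_ofNat]
    refine ⟨.atom ((codeLeft m).unpair.1, (codeLeft m).unpair.2) fun i => L.get (i.cast hlen.symm),
      ?_⟩
    rw [Formula.code]
    have : List.ofFn (fun i : Fin (codeLeft m).unpair.1 => L.get (i.cast hlen.symm)) = L := by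
      rw [← List.ofFn_congr hlen, List.ofFn_get]
    change Nat.pair 0 (Nat.pair (Nat.pair _ _) (Encodable.encode (List.ofFn _))) = m
    rw [this, hL', Nat.pair_unpair, h₂, ← h, h₁]
  · obtain ⟨X, hX⟩ := codeSet_surjective (codeLeft m)
    exact ⟨.dep X (codeRight m), by rw [Formula.code, hX, h₂, ← h, h₁]⟩
  · obtain ⟨φ, hφ⟩ := ih _ (by omega) ha
    exact ⟨.neg φ, by rw [Formula.code, hφ, ← h, h₁]⟩
  · obtain ⟨φ, hφ⟩ := ih _ (by omega) ha
    obtain ⟨ψ, hψ⟩ := ih _ (by omega) ha'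
    exact ⟨.and φ ψ, by rw [Formula.code, hφ, hψ, h₂, ← h, h₁]⟩
  · obtain ⟨φ, hφ⟩ := ih _ (by omega) ha
    obtain ⟨X, hX⟩ := codeSet_surjective (boxX m)
    obtain ⟨Y, hY⟩ := codeSet_surjective (boxY m)
    obtain ⟨Z, hZ⟩ := codeSet_surjective (boxZ m)
    exact ⟨.box X Y Z φ, by rw [Formula.code, hφ, hX, hY, hZ, h₃, h₄, h₂, ← h, h₁]⟩

theorem CodesClosed.subClosed {g : ℕ} (hg : CodesClosed g) : SubClosed (maskFormulas g) where
  neg φ h := by simpa using hg _ (MaskMem.lt h) h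
  and φ ψ h := by simpa using hg _ (MaskMem.lt h) h
  box X Y Z φ h := by simpa using hg _ (MaskMem.lt h) h

theorem CodeCompat.compat {g t s : ℕ} {X Y Z : Finset Var}
    (h : CodeCompat g t s (codeSet X) (codeSet Y) (codeSet Z)) :
    Compat (maskFormulas g) (maskFormulas t) (maskFormulas s) ⟨X, Y, Z⟩ where
  atom φ hφ hat := h.1 _ (MaskMem.lt hφ) hφ ((codeAtomOver_code X φ).2 hat)
  closed Y' z hG hY' hd := by
    simpa using h.2.1 _ (MaskMem.lt hG) hG (by simp) (by simpa using hY') hd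
  forward X' Y' Z' Z'' φ hφ hX' hY' hZY hZ' hZ'' := by
    have := h.2.2.1 _ (MaskMem.lt hφ) hφ (by simp) (by simpa using hX') (by simpa using hY')
      (by simpa using hZY) (codeSet Z'') (by
        rw [boxZ_box]
        exact Nat.lt_succ_of_le (codeSet_le_of_subset hZ')) (by simpa using hZ')
      (by simpa using hZ'')
    simpa using this
  backward X' Y' Z' φ hφ hX' hY' hZY :=
    h.2.2.2 _ (MaskMem.lt hφ) hφ (by simp) (by simpa using hX') (by simpa using hY')
      (by simpa using hZY)

theorem hintikka_of_code {b g f : ℕ}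
    (h : ∀ t < f, MaskMem t f → CodeLocal g t ∧ CodeWitnessed b g f t) :
    Hintikka (maskFormulas g) (fun t : {t // MaskMem t f} => maskFormulas t.1) := by
  have h₁ : ∀ t : {t // MaskMem t f}, CodeLocal g t.1 := fun t => (h t.1 t.2.lt t.2).1
  have h₂ : ∀ t : {t // MaskMem t f}, CodeWitnessed b g f t.1 := fun t => (h t.1 t.2.lt t.2).2
  refine ⟨fun t φ hφ => ?_, fun t φ ψ hφ => ?_, fun t X Y φ hφ => ?_, fun t X Y Z φ hφ h => ?_,
    fun t Y z hd hn => ?_, fun t X Y Z φ hφ hn => ?_⟩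
  · simpa using (h₁ t).1 _ (MaskMem.lt hφ) hφ (by simp)
  · simpa using (h₁ t).2.1 _ (MaskMem.lt hφ) hφ (by simp)
  · simpa using (h₁ t).2.2.1 _ (MaskMem.lt hφ) hφ (by simp) (by simp [codeSet])
  · have := (h₁ t).2.2.2 _ (MaskMem.lt hφ) hφ h (by simp) (codeSet (Y ∪ Z))
      (by simpa using Nat.lt_succ_of_le (codeSet_union_le Y Z)) (by simp) (by simp) (by simp)
    simpa using this
  · obtain ⟨s, -, hs, X', -, Y', -, Z', -, hc, hX, hz⟩ :=
      (h₂ t).1 _ (MaskMem.lt hd) hd (by simp) hn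
    obtain ⟨X', rfl⟩ := codeSet_surjective X'
    obtain ⟨Y', rfl⟩ := codeSet_surjective Y'
    obtain ⟨Z', rfl⟩ := codeSet_surjective Z'
    exact ⟨⟨s, hs⟩, _, hc.compat, by simpa using hX, by simpa using hz⟩
  · obtain ⟨s, -, hs, X', -, Y', -, Z', -, hc, hX, hY, hZ, hz⟩ :=
      (h₂ t).2 _ (MaskMem.lt hφ) hφ (by simp) hn
    obtain ⟨X', rfl⟩ := codeSet_surjective X'
    obtain ⟨Y', rfl⟩ := codeSet_surjective Y'
    obtain ⟨Z', rfl⟩ := codeSet_surjective Z'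
    exact ⟨⟨s, hs⟩, _, hc.compat, by simpa using hX, by simpa using hY, by simpa using hZ,
      by simpa using hz⟩

theorem HasCertificate.satisfiable {n : ℕ} (h : HasCertificate n) :
    ∃ φ : Formula, φ.code = n ∧ Satisfiable.{u} φ := by
  obtain ⟨g, -, f, -, hg, hn, ⟨t, -, ht, hnt⟩, hT⟩ := h
  obtain ⟨φ, rfl⟩ := exists_formula_of_codesClosed hg hn
  refine ⟨φ, rfl, (hintikka_of_code hT).satisfiable (r := ⟨t, ht⟩) hg.subClosed hn ?_⟩
  exact mem_maskFormulas.2 hnt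

/-! ### Certificates from models -/

theorem exists_of_codeTag_eq_one {φ : Formula} (h : codeTag φ.code = 1) :
    ∃ X y, φ = .dep X y := by
  cases φ <;> simp at h ⊢

theorem exists_of_codeTag_eq_two {φ : Formula} (h : codeTag φ.code = 2) :
    ∃ ψ, φ = .neg ψ := by
  cases φ <;> simp at h ⊢

theorem exists_of_codeTag_eq_three {φ : Formula} (h : codeTag φ.code = 3) :
    ∃ ψ χ, φ = .and ψ χ := by
  cases φ <;> simp at h ⊢

theorem exists_of_codeTag_eq_four {φ : Formula} (h : codeTag φ.code = 4) :
    ∃ X Y Z ψ, φ = .box X Y Z ψ := by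
  cases φ <;> simp at h ⊢

theorem pair_le_pair {a b c d : ℕ} (h : a ≤ c) (h' : b ≤ d) : Nat.pair a b ≤ Nat.pair c d := by
  refine le_trans (b := Nat.pair c b) ?_ ?_
  · rcases h.eq_or_lt with rfl | h
    · exact le_rfl
    · exact (Nat.pair_lt_pair_left b h).le
  · rcases h'.eq_or_lt with rfl | h'
    · exact le_rfl
    · exact (Nat.pair_lt_pair_right c h').le

theorem boxCode_le {X Y Z m X' Y' Z' m' : ℕ} (hX : X ≤ X') (hY : Y ≤ Y') (hZ : Z ≤ Z')
    (hm : m ≤ m') : boxCode X Y Z m ≤ boxCode X' Y' Z' m' :=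
  pair_le_pair le_rfl (pair_le_pair (pair_le_pair hX hY) (pair_le_pair hZ hm))

theorem le_boxCode (X Y Z m : ℕ) :
    X ≤ boxCode X Y Z m ∧ Y ≤ boxCode X Y Z m ∧ Z ≤ boxCode X Y Z m ∧ m ≤ boxCode X Y Z m := by
  have h₁ := Nat.right_le_pair 4 (Nat.pair (Nat.pair X Y) (Nat.pair Z m))
  have h₂ := Nat.left_le_pair (Nat.pair X Y) (Nat.pair Z m)
  have h₃ := Nat.right_le_pair (Nat.pair X Y) (Nat.pair Z m)
  have h₄ := Nat.left_le_pair X Y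
  have h₅ := Nat.right_le_pair X Y
  have h₆ := Nat.left_le_pair Z m
  have h₇ := Nat.right_le_pair Z m
  unfold boxCode
  omega

theorem lt_codeBound {n m : ℕ} (h : m ≤ n) : m < codeBound n :=
  Nat.lt_succ_of_le (h.trans (le_boxCode n (n + n) n n).1)

theorem subset_range_of_codeSet_le {X : Finset ℕ} {n : ℕ} (h : codeSet X ≤ n) :
    X ⊆ Finset.range (n + 1) := by
  intro i hi
  have := (maskMem_codeSet.2 hi).lt
  rw [Finset.mem_range]
  omega

section Model

variable (M : PDModel.{u}) (n : ℕ)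

open Classical in
/-- The mask of the set of Gödel numbers of formulas, up to a bound that depends on `n`, that are
true at `a`. -/
noncomputable def theoryMask (a : M.A) : ℕ :=
  codeSet ((Finset.range (codeBound n)).filter fun m => ∃ φ : Formula, φ.code = m ∧ M.Sat a φ)

open Classical in
/-- The mask of the set of Gödel numbers of formulas up to `n`. -/
noncomputable def formulaMask : ℕ :=
  codeSet ((Finset.range (n + 1)).filter fun m => ∃ φ : Formula, φ.code = m)

open Classical in
/-- The variables up to `n` on which `a` and `b` agree, those for which they are equally good, and
those for which `b` is strictly better. -/
noncomputable def stepLabel (a b : M.A) : Label where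
  X := (Finset.range (n + 1)).filter fun x => a.1 x = b.1 x
  Y := (Finset.range (n + 1)).filter fun y => M.pref y a b ∧ M.pref y b a
  Z := (Finset.range (n + 1)).filter fun z => M.strict z a b

variable {M n}

theorem maskMem_theoryMask {a : M.A} {m : ℕ} : MaskMem m (theoryMask M n a) ↔
    m < codeBound n ∧ ∃ φ : Formula, φ.code = m ∧ M.Sat a φ := by
  classical
  rw [theoryMask, maskMem_codeSet, Finset.mem_filter, Finset.mem_range]

theorem maskMem_theoryMask_code {a : M.A} {φ : Formula} (h : φ.code < codeBound n) :
    MaskMem φ.code (theoryMask M n a) ↔ M.Sat a φ := by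
  rw [maskMem_theoryMask, and_iff_right h]
  exact ⟨fun ⟨ψ, hψ, hs⟩ => Formula.code_injective hψ ▸ hs, fun hs => ⟨φ, rfl, hs⟩⟩

theorem maskMem_formulaMask {m : ℕ} : MaskMem m (formulaMask n) ↔
    m ≤ n ∧ ∃ φ : Formula, φ.code = m := by
  classical
  rw [formulaMask, maskMem_codeSet, Finset.mem_filter, Finset.mem_range, Nat.lt_succ_iff]

theorem PDModel.sat_box_of_step {a b : M.A} {X Y Z Z' : Finset Var} {φ : Formula}
    (hX : M.agree X a b) (hY : ∀ y ∈ Y, M.pref y a b) (hZY : Z ⊆ Y)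
    (hZ : ∀ z ∈ Z, z ∈ Z' ∨ M.strict z a b) (h : M.Sat a (.box X Y Z φ)) :
    M.Sat b (.box X Y Z' φ) := by
  intro c hX' hY' hZ'
  refine h c (hX.trans hX') (fun y hy => M.pref_trans _ _ _ _ (hY y hy) (hY' y hy)) fun z hz => ?_
  rcases hZ z hz with h' | h'
  · exact .pref_trans (hY z (hZY hz)) (hZ' z h')
  · exact h'.trans_pref (hY' z (hZY hz))

theorem mem_stepLabel_X {a b : M.A} {x : Var} :
    x ∈ (stepLabel M n a b).X ↔ x ∈ Finset.range (n + 1) ∧ a.1 x = b.1 x := by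
  classical exact Finset.mem_filter

theorem subset_stepLabel_X {a b : M.A} {X : Finset Var} :
    X ⊆ (stepLabel M n a b).X ↔ X ⊆ Finset.range (n + 1) ∧ M.agree X a b :=
  ⟨fun h => ⟨fun _ hx => (mem_stepLabel_X.1 (h hx)).1, fun _ hx => (mem_stepLabel_X.1 (h hx)).2⟩,
    fun h x hx => mem_stepLabel_X.2 ⟨h.1 hx, h.2 x hx⟩⟩

theorem mem_stepLabel_Y {a b : M.A} {y : Var} :
    y ∈ (stepLabel M n a b).Y ↔ y ∈ Finset.range (n + 1) ∧ M.pref y a b ∧ M.pref y b a := by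
  classical exact Finset.mem_filter

theorem mem_stepLabel_Z {a b : M.A} {z : Var} :
    z ∈ (stepLabel M n a b).Z ↔ z ∈ Finset.range (n + 1) ∧ M.strict z a b := by
  classical exact Finset.mem_filter

theorem codesClosed_formulaMask : CodesClosed (formulaMask n) := by
  intro m _ hm
  obtain ⟨hm, φ, rfl⟩ := maskMem_formulaMask.1 hm
  cases φ with
  | atom P x => simp
  | dep X y => simp
  | neg φ =>
    have := Nat.right_le_pair 2 φ.code
    simp only [Formula.code] at hm
    simpa using maskMem_formulaMask.2 ⟨this.trans hm, _, rfl⟩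
  | and φ ψ =>
    have h₁ := Nat.right_le_pair 3 (Nat.pair φ.code ψ.code)
    have h₂ := Nat.left_le_pair φ.code ψ.code
    have h₃ := Nat.right_le_pair φ.code ψ.code
    simp only [Formula.code] at hm
    simpa using And.intro (maskMem_formulaMask.2 ⟨(h₂.trans h₁).trans hm, φ, rfl⟩)
      (maskMem_formulaMask.2 ⟨(h₃.trans h₁).trans hm, ψ, rfl⟩)
  | box X Y Z φ =>
    have := (le_boxCode (codeSet X) (codeSet Y) (codeSet Z) φ.code).2.2.2
    simpa using maskMem_formulaMask.2 ⟨this.trans hm, _, rfl⟩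

theorem codeCompat_of_model (a b : M.A) :
    CodeCompat (formulaMask n) (theoryMask M n a) (theoryMask M n b)
      (codeSet (stepLabel M n a b).X) (codeSet (stepLabel M n a b).Y)
      (codeSet (stepLabel M n a b).Z) := by
  refine ⟨fun m _ hm hat => ?_, fun m _ hm htag hX hd => ?_,
    fun m _ hm htag hX hY hZY z hz hzZ hZ => ?_, fun m _ hm htag hX hY hZY => ?_⟩
  · obtain ⟨hm, φ, rfl⟩ := maskMem_formulaMask.1 hm
    rw [codeAtomOver_code] at hat
    rw [maskMem_theoryMask_code (lt_codeBound hm), maskMem_theoryMask_code (lt_codeBound hm)]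
    exact PDModel.sat_congr_of_atomOver hat (subset_stepLabel_X.1 subset_rfl).2
  · obtain ⟨hm, φ, rfl⟩ := maskMem_formulaMask.1 hm
    obtain ⟨X, y, rfl⟩ := exists_of_codeTag_eq_one htag
    rw [maskMem_theoryMask_code (lt_codeBound hm)] at hd
    rw [codeLeft_dep, maskSub_codeSet] at hX
    rw [codeRight_dep, maskMem_codeSet, mem_stepLabel_X, Finset.mem_range, Nat.lt_succ_iff]
    refine ⟨?_, hd b (subset_stepLabel_X.1 hX).2⟩
    rw [Formula.code] at hm
    exact ((Nat.right_le_pair _ _).trans (Nat.right_le_pair _ _)).trans hm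
  · obtain ⟨hm, φ, rfl, hφ⟩ := maskMem_theoryMask.1 hm
    obtain ⟨X, Y, Z, φ, rfl⟩ := exists_of_codeTag_eq_four htag
    obtain ⟨Z', rfl⟩ := codeSet_surjective z
    simp only [boxX_box, boxY_box, boxZ_box, boxBody_box, maskSub_codeSet, maskSubUnion_codeSet,
      boxCode_code] at hX hY hZY hz hzZ hZ ⊢
    have hlt : (Formula.box X Y Z' φ).code < codeBound n :=
      (boxCode_le le_rfl le_rfl (Nat.lt_succ_iff.1 hz) le_rfl).trans_lt hm
    rw [maskMem_theoryMask_code hlt]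
    refine PDModel.sat_box_of_step (subset_stepLabel_X.1 hX).2 (fun y hy => ?_) hZY
      (fun z hz => ?_) hφ
    · rcases Finset.mem_union.1 (hY hy) with h | h
      · exact (mem_stepLabel_Y.1 h).2.1
      · exact (mem_stepLabel_Z.1 h).2.1
    · exact (Finset.mem_union.1 (hZ hz)).imp_right fun h => (mem_stepLabel_Z.1 h).2
  · obtain ⟨hm, φ, rfl, hφ⟩ := maskMem_theoryMask.1 hm
    obtain ⟨X, Y, Z, φ, rfl⟩ := exists_of_codeTag_eq_four htag
    simp only [boxX_box, boxY_box, boxZ_box, maskSub_codeSet] at hX hY hZY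
    rw [maskMem_theoryMask_code hm]
    exact PDModel.sat_box_of_step (subset_stepLabel_X.1 hX).2.symm
      (fun y hy => (mem_stepLabel_Y.1 (hY hy)).2.2) hZY (fun z hz => Or.inl hz) hφ

theorem codeLocal_of_model (a : M.A) : CodeLocal (formulaMask n) (theoryMask M n a) := by
  refine ⟨fun m _ hm htag => ?_, fun m _ hm htag => ?_, fun m _ hm htag hZ => ?_,
    fun m _ hm hs htag y hy hYy hZy hy' => ?_⟩
  · have hc := codesClosed_formulaMask m hm.lt hm
    obtain ⟨hm, φ, rfl⟩ := maskMem_formulaMask.1 hm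
    obtain ⟨φ, rfl⟩ := exists_of_codeTag_eq_two htag
    have hφ : MaskMem φ.code (formulaMask n) := by simpa using hc
    rw [codeArg_neg, maskMem_theoryMask_code (lt_codeBound hm),
      maskMem_theoryMask_code (lt_codeBound (maskMem_formulaMask.1 hφ).1), PDModel.Sat]
  · have hc := codesClosed_formulaMask m hm.lt hm
    obtain ⟨hm, φ, rfl⟩ := maskMem_formulaMask.1 hm
    obtain ⟨φ, ψ, rfl⟩ := exists_of_codeTag_eq_three htag
    have hφ : MaskMem φ.code (formulaMask n) ∧ MaskMem ψ.code (formulaMask n) := by simpa using hc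
    rw [codeLeft_and, codeRight_and, maskMem_theoryMask_code (lt_codeBound hm),
      maskMem_theoryMask_code (lt_codeBound (maskMem_formulaMask.1 hφ.1).1),
      maskMem_theoryMask_code (lt_codeBound (maskMem_formulaMask.1 hφ.2).1), PDModel.Sat]
  · obtain ⟨hm, φ, rfl, hφ⟩ := maskMem_theoryMask.1 hm
    obtain ⟨X, Y, Z, φ, rfl⟩ := exists_of_codeTag_eq_four htag
    obtain rfl : Z = ∅ := Formula.codeSet_injective (by simpa [codeSet] using hZ)
    rw [boxBody_box, maskMem_theoryMask_code ((le_boxCode _ _ _ _).2.2.2.trans_lt hm)]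
    exact hφ a (fun _ _ => rfl) (fun y _ => M.pref_refl y a) (by simp)
  · obtain ⟨hm, φ, rfl⟩ := maskMem_formulaMask.1 hm
    obtain ⟨X, Y, Z, φ, rfl⟩ := exists_of_codeTag_eq_four htag
    obtain ⟨U, rfl⟩ := codeSet_surjective y
    rw [maskMem_theoryMask_code (lt_codeBound hm)] at hs
    simp only [boxX_box, boxY_box, boxZ_box, boxBody_box, maskSub_codeSet, boxCode_code]
      at hy hYy ⊢
    have hle := le_boxCode (codeSet X) (codeSet Y) (codeSet Z) φ.code
    rw [maskMem_theoryMask_code]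
    · exact fun b hX hY hZ => hs b hX (fun y hy => hY y (hYy hy)) hZ
    · -- the mask of the union `U` is bounded by the sum of two masks, whence `n + n` in `codeBound`
      refine Nat.lt_succ_of_le (boxCode_le (hle.1.trans hm) ?_ (hle.2.2.1.trans hm)
        (hle.2.2.2.trans hm))
      exact (Nat.lt_succ_iff.1 hy).trans (add_le_add (hle.2.1.trans hm) (hle.2.2.1.trans hm))

theorem codeWitnessed_of_model {f : ℕ} (hf : ∀ a, MaskMem (theoryMask M n a) f) (a : M.A) :
    CodeWitnessed (2 ^ (n + 1)) (formulaMask n) f (theoryMask M n a) := by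
  have hlt : ∀ X ⊆ Finset.range (n + 1), codeSet X < 2 ^ (n + 1) :=
    fun X hX => codeSet_lt fun i hi => Finset.mem_range.1 (hX hi)
  have hlabel : ∀ b, codeSet (stepLabel M n a b).X < 2 ^ (n + 1) ∧
      codeSet (stepLabel M n a b).Y < 2 ^ (n + 1) ∧
      codeSet (stepLabel M n a b).Z < 2 ^ (n + 1) := fun b =>
    ⟨hlt _ fun _ hx => (mem_stepLabel_X.1 hx).1, hlt _ fun _ hy => (mem_stepLabel_Y.1 hy).1,
      hlt _ fun _ hz => (mem_stepLabel_Z.1 hz).1⟩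
  refine ⟨fun m _ hm htag hn => ?_, fun m _ hm htag hn => ?_⟩
  · obtain ⟨hm, φ, rfl⟩ := maskMem_formulaMask.1 hm
    obtain ⟨X, y, rfl⟩ := exists_of_codeTag_eq_one htag
    rw [maskMem_theoryMask_code (lt_codeBound hm), PDModel.Sat] at hn
    push Not at hn
    obtain ⟨b, hX, hy⟩ := hn
    refine ⟨_, (hf b).lt, hf b, _, (hlabel b).1, _, (hlabel b).2.1, _, (hlabel b).2.2,
      codeCompat_of_model a b, ?_, ?_⟩
    · rw [codeLeft_dep, maskSub_codeSet, subset_stepLabel_X]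
      refine ⟨subset_range_of_codeSet_le (le_trans ?_ hm), hX⟩
      exact (Nat.left_le_pair _ _).trans (Nat.right_le_pair 1 (Nat.pair (codeSet X) y))
    · rw [codeRight_dep, maskMem_codeSet, mem_stepLabel_X]
      exact fun h => hy h.2
  · obtain ⟨hm, φ, rfl⟩ := maskMem_formulaMask.1 hm
    obtain ⟨X, Y, Z, φ, rfl⟩ := exists_of_codeTag_eq_four htag
    have hle := le_boxCode (codeSet X) (codeSet Y) (codeSet Z) φ.code
    rw [maskMem_theoryMask_code (lt_codeBound hm), PDModel.Sat] at hn
    push Not at hn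
    obtain ⟨b, hX, hY, hZ, hb⟩ := hn
    refine ⟨_, (hf b).lt, hf b, _, (hlabel b).1, _, (hlabel b).2.1, _, (hlabel b).2.2,
      codeCompat_of_model a b, ?_, ?_, ?_, ?_⟩
    · rw [boxX_box, maskSub_codeSet, subset_stepLabel_X]
      exact ⟨subset_range_of_codeSet_le (hle.1.trans hm), hX⟩
    · rw [boxY_box, maskSubUnion_codeSet]
      intro y hy
      have hyn := subset_range_of_codeSet_le (hle.2.1.trans hm) hy
      rw [Finset.mem_union, mem_stepLabel_Y, mem_stepLabel_Z]
      by_cases h : M.pref y b a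
      · exact Or.inl ⟨hyn, hY y hy, h⟩
      · exact Or.inr ⟨hyn, hY y hy, h⟩
    · rw [boxZ_box, maskSub_codeSet]
      exact fun z hz => mem_stepLabel_Z.2
        ⟨subset_range_of_codeSet_le (hle.2.2.1.trans hm) hz, hZ z hz⟩
    · rw [boxBody_box, maskMem_theoryMask_code (lt_codeBound (hle.2.2.2.trans hm))]
      exact hb

end Model

theorem Satisfiable.hasCertificate {φ : Formula} (h : Satisfiable.{u} φ) :
    HasCertificate φ.code := by
  classical
  obtain ⟨M, a, ha⟩ := h
  have hlt : ∀ b, theoryMask M φ.code b < 2 ^ codeBound φ.code := fun b =>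
    codeSet_lt fun m hm => Finset.mem_range.1 (Finset.mem_filter.1 hm).1
  let f := codeSet ((Finset.range (2 ^ codeBound φ.code)).filter fun t =>
    ∃ b, theoryMask M φ.code b = t)
  have hf : ∀ t, MaskMem t f ↔ ∃ b, theoryMask M φ.code b = t := by
    intro t
    rw [maskMem_codeSet, Finset.mem_filter, Finset.mem_range, and_iff_right_iff_imp]
    rintro ⟨b, rfl⟩
    exact hlt b
  have hf' : ∀ b, MaskMem (theoryMask M φ.code b) f := fun b => (hf _).2 ⟨b, rfl⟩
  refine ⟨formulaMask φ.code, ?_, f, ?_, codesClosed_formulaMask,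
    maskMem_formulaMask.2 ⟨le_rfl, φ, rfl⟩, ⟨_, (hf' a).lt, hf' a,
      (maskMem_theoryMask_code (lt_codeBound le_rfl)).2 ha⟩, fun t _ ht => ?_⟩
  · exact codeSet_lt fun m hm => Finset.mem_range.1 (Finset.mem_filter.1 hm).1
  · exact codeSet_lt fun m hm => Finset.mem_range.1 (Finset.mem_filter.1 hm).1
  · obtain ⟨b, rfl⟩ := (hf t).1 ht
    exact ⟨codeLocal_of_model b, codeWitnessed_of_model hf' b⟩

theorem computablePred_satisfiable :
    ComputablePred fun n : ℕ => ∃ φ : Formula, φ.code = n ∧ Satisfiable.{u} φ :=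
  primrecPred_hasCertificate.computablePred.of_eq fun _ =>
    ⟨HasCertificate.satisfiable, by rintro ⟨φ, rfl, h⟩; exact h.hasCertificate⟩

end LPFD

theorem mainTheorem2 :
    ComputablePred (fun n : ℕ => ∃ φ : LPFD.Formula, φ.code = n ∧ LPFD.Satisfiable.{u} φ) ∧
    ∀ α : LPFD.Formula,
      (LPFD.Satisfiable.{u} α ↔
        ∃ F : Set (Set LPFD.Formula), LPFD.IsPreModel α F ∧ LPFD.SatisfiedIn F α) ∧
      (∃ S : Set LPFD.Formula, S.Finite ∧ S ⊆ LPFD.Fragment α ∧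
        ∀ φ ∈ LPFD.Fragment α, ∃ ψ ∈ S, LPFD.Equivalent.{u} φ ψ) ∧
      {Γ : Set LPFD.Formula | LPFD.IsMCS α Γ}.Finite :=
  ⟨LPFD.computablePred_satisfiable, fun α => ⟨LPFD.satisfiable_iff_exists_preModel α,
    LPFD.exists_finite_fragment_representatives α, LPFD.finite_setOf_isMCS α⟩⟩
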